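/- **Setting.** Order $\mathbb R^2$ coordinatewise. A ($2$-parameter) persistence module over a field $\mathbb F$ assigns to each $u\in\mathbb R^2$ a vector space $M_u$ and to each $u\preceq v$ a linear map $i_M(u,v):M_u\to M_v$, with $i_M(u,u)=\mathrm{id}$ and $i_M(v,w)\circ i_M(u,v)=i_M(u,w)$. Let $M,N$ be two such modules with all $M_u,N_u$ finite dimensional (for example, finitely presented modules), not both zero. *Lines.* A line $L$ of positive slope is always parametrized as $s\mapsto s\vec m+b$ with $m_1,m_2>0$, $\max(m_1,m_2)=1$, $b_1+b_2=0$; put $\hat m^L=\min(m_1,m_2)$. $M^L$ is the $1$-parameter module $s\mapsto M_{s\vec m+b}$; its persistence diagram $\mathrm{dgm}\,M^L$ is the multiset of the pairs $(\beta,d)$, $\beta<d\le\infty$, in a decomposition of $M^L$ as a finite direct sum of interval modules $I[\beta,d)$. The bottleneck distance $d_B\in[0,\infty]$ is the minimum, over all multi-bijections $\sigma$ between a sub-multiset of one diagram and a sub-multiset of the other, of the largest of the numbers $\|p-\sigma(p)\|_\infty$ for matched points $p$ and $(p_2-p_1)/2$ for unmatched points $p$ (with $\infty-\infty=0$, $\infty-a=\infty$).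 In the projective plane $\mathbb P^2=\mathbb R^2\cup\ell_\infty$, the point $u\in\mathbb R^2$ is $[1:u_1:u_2]$ (a proper point), and $L$ passes, besides its proper points, through the point $[0:m_1:m_2]$ at infinity. For $u\in\mathbb R^2$, let $p_L(u)=\max_i (u_i-b_i)/m_i$ be the parameter of the unique point of $L$ on the boundary of the cone $\{v: u\preceq v\}$. For a set $U\subseteq\mathbb P^2$, write $L\sim_U L'$ if each proper $u\in U$ lies on $L$, strictly to its left, or strictly to its right exactly when the same holds for $L'$, and for each $[0:v_1:v_2]\in U$ with $v_1,v_2>0$, the slope of $L$ is equal to, larger than, or smaller than $v_2/v_1$ exactly when the same holds for the slope of $L'$. *Property (P).* $C_M,C_N\subset\mathbb R^2$ are finite sets with closures $\overline C_M,\overline C_N$ under (coordinatewise) least upper bounds such that, for all $u\preceq v$, $\mathrm{rank}\,i_M(u,v)=\mathrm{rank}\,i_M(\bar u,\bar v)$, where $\bar u=\max\{c\in\overline C_M: c\preceq u\}$ and $\bar v=\max\{c\in\overline C_M: c\preceq v\}$, if $\{c\in\overline C_M: c\preceq u\}\neq\emptyset$, and $\mathrm{rank}\,i_M(u,v)=0$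 otherwise; likewise for $N$ and $C_N$. *Property (Q).* $\Omega\subset\mathbb P^2$ is a finite set such that, for all $u,v,w,x\in\overline C_M\cup\overline C_N$ and $\delta,\eta\in\{1,2\}$, the sign (positive, negative or zero) of $$\frac{|p_L(u)-p_L(v)|}{\delta}-\frac{|p_L(w)-p_L(x)|}{\eta}$$ is the same for any two lines of positive slope that are equivalent under $\sim_{\overline C_M\cup\overline C_N\cup\Omega}$. Let $\Omega_P=\Omega\cap\mathbb R^2$ and $\overline\Omega=\Omega\cup\{[0:1:1]\}$. **Statement.** For every vertical line $V$, the limit $$\mathrm{cost}(V):=\lim_{m_1\to0^+}\hat m^L\,d_B(\mathrm{dgm}\,M^L,\mathrm{dgm}\,N^L)\in[0,\infty],$$ taken over the lines $L$ of positive slope through a fixed point $r\in V$, exists and does not depend on $r$, and there is a line $L$ of positive slope that passes through a (proper) point of $\overline C_M\cup\overline C_N\cup\Omega_P$ and a different point of $\overline C_M\cup\overline C_N\cup\overline\Omega$, such that $$\mathrm{cost}(V)\le\hat m^L\,d_B(\mathrm{dgm}\,M^L,\mathrm{dgm}\,N^L).$$ The same holds for every horizontal line $V$, with the limit taken as $m_2\to0^+$.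 -/

import Mathlib

open Filter Topology
open scoped ENNReal LinearAlgebra.Projectivization

namespace MatchingDistance

universe u w w₁ w₂

/-! ## Persistence modules -/

/-- The parameter space `ℝ²`, with its coordinatewise partial order.  Coordinates are indexed by
`0` (horizontal) and `1` (vertical). -/
abbrev Plane : Type := Fin 2 → ℝ

/-- A persistence module over a field `F`, indexed by a preorder `P`. -/
structure PersistenceModule (F : Type u) [Field F] (P : Type) [Preorder P] where
  obj : P → Type w
  [addCommGroup : ∀ p, AddCommGroup (obj p)]
  [module : ∀ p, Module F (obj p)]
  map : ∀ {p q : P}, p ≤ q → (obj p →ₗ[F] obj q)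
  map_refl : ∀ p : P, map (le_refl p) = LinearMap.id
  map_trans : ∀ {p q r : P} (hpq : p ≤ q) (hqr : q ≤ r),
    map hqr ∘ₗ map hpq = map (hpq.trans hqr)

attribute [instance] PersistenceModule.addCommGroup PersistenceModule.module

namespace PersistenceModule

section General

variable {F : Type u} [Field F] {P : Type} [Preorder P]

/-- All the vector spaces of the module are finite dimensional (this holds for every finitely
presented module). -/
def PointwiseFinite (M : PersistenceModule.{u, w} F P) : Prop :=
  ∀ p, Module.Finite F (M.obj p)

/-- The zero module. -/
def IsTrivial (M : PersistenceModule.{u, w} F P) : Prop :=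
  ∀ p, Subsingleton (M.obj p)

/-- The rank of a transition map. -/
noncomputable def rank (M : PersistenceModule.{u, w} F P) {p q : P} (h : p ≤ q) : ℕ :=
  Module.finrank F (LinearMap.range (M.map h))

/-- Isomorphism of persistence modules. -/
def Isomorphic (M : PersistenceModule.{u, w₁} F P)
    (N : PersistenceModule.{u, w₂} F P) : Prop :=
  ∃ e : ∀ p, M.obj p ≃ₗ[F] N.obj p,
    ∀ (p q : P) (h : p ≤ q) (x : M.obj p), e q (M.map h x) = N.map h (e p x)

/-- The direct sum of a finite family of persistence modules. -/
def directSum {n : ℕ} (M : Fin n → PersistenceModule.{u, w} F P) :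
    PersistenceModule.{u, w} F P where
  obj p := ∀ j, (M j).obj p
  map h := LinearMap.pi fun j => (M j).map h ∘ₗ LinearMap.proj j
  map_refl p := by
    ext x j
    simp [(M _).map_refl]
  map_trans hpq hqr := by
    refine LinearMap.ext fun x => funext fun j => ?_
    simpa using LinearMap.congr_fun ((M j).map_trans hpq hqr) (x j)

end General

/-! ## Interval modules and persistence diagrams -/

/-- Membership of `s` in the half-open interval `[b, d)`, where `I = (b, d)`, `d ≤ ∞`. -/
def InInterval (I : ℝ × WithTop ℝ) (s : ℝ) : Prop :=
  I.1 ≤ s ∧ (s : WithTop ℝ) < I.2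

/-- The space of the interval module at `s`: all of `F` if `s ∈ [b, d)`, and `0` otherwise. -/
def intervalSpace (F : Type u) [Field F] (I : ℝ × WithTop ℝ) (s : ℝ) : Submodule F F where
  carrier := {x | ¬ InInterval I s → x = 0}
  add_mem' hx hy h := by simp [hx h, hy h]
  zero_mem' _ := rfl
  smul_mem' c x hx h := by simp [hx h]

open Classical in
/-- The interval module `I[b, d)`: the transition map from `s` to `t` is the identity if both `s`
and `t` lie in `[b, d)`, and zero otherwise. -/
noncomputable def interval (F : Type u) [Field F] (I : ℝ × WithTop ℝ) :
    PersistenceModule.{u, u} F ℝ where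
  obj s := intervalSpace F I s
  map {s t} _ :=
    LinearMap.codRestrict (intervalSpace F I t)
      (if InInterval I t then (intervalSpace F I s).subtype else 0)
      (fun x h => by simp [h])
  map_refl s := by
    refine LinearMap.ext fun x => Subtype.ext ?_
    by_cases h : InInterval I s
    · simp [h]
    · simpa [h] using (x.2 h).symm
  map_trans {p q r} hpq hqr := by
    refine LinearMap.ext fun x => Subtype.ext ?_
    by_cases hr : InInterval I r
    · by_cases hq : InInterval I q
      · simp [hr, hq]
      · have hp : ¬ InInterval I p := fun hp =>
          hq ⟨hp.1.trans hpq, lt_of_le_of_lt (WithTop.coe_le_coe.2 hqr) hr.2⟩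
        have hx : (x : F) = 0 := x.2 hp
        simp [hr, hq, hx]
    · simp [hr]

/-- `D` is the multiset of the intervals in a decomposition of the one-parameter module `M` as a
finite direct sum of interval modules. -/
def IsDiagram {F : Type u} [Field F] (M : PersistenceModule.{u, w} F ℝ)
    (D : Multiset (ℝ × WithTop ℝ)) : Prop :=
  (∀ I ∈ D, (I.1 : WithTop ℝ) < I.2) ∧
    ∃ (n : ℕ) (I : Fin n → ℝ × WithTop ℝ),
      D = Finset.univ.val.map I ∧ M.Isomorphic (directSum fun j => interval F (I j))

/-- The persistence diagram of a one-parameter module (which is determined by the module as soon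
as the latter has a finite decomposition into interval modules). -/
noncomputable def dgm {F : Type u} [Field F] (M : PersistenceModule.{u, w} F ℝ) :
    Multiset (ℝ × WithTop ℝ) :=
  Classical.epsilon M.IsDiagram

end PersistenceModule

/-! ## The bottleneck distance -/

/-- The distance of two elements of `ℝ ∪ {∞}`, with `∞ - ∞ = 0` and `∞ - a = ∞`. -/
noncomputable def extDist : WithTop ℝ → WithTop ℝ → ℝ≥0∞
  | some x, some y => ENNReal.ofReal |x - y|
  | none, none => 0
  | _, _ => ∞

/-- The `ℓ^∞` distance of two points of `ℝ × (ℝ ∪ {∞})`. -/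
noncomputable def pairCost (p q : ℝ × WithTop ℝ) : ℝ≥0∞ :=
  max (extDist p.1 q.1) (extDist p.2 q.2)

/-- The `ℓ^∞` distance `(p₂ - p₁) / 2` of a point to the diagonal. -/
noncomputable def diagCost (p : ℝ × WithTop ℝ) : ℝ≥0∞ :=
  extDist p.1 p.2 / 2

/-- A matching between the multisets `A` and `B`, given as the multiset of its matched pairs: it is
a multi-bijection between a sub-multiset of `A` and a sub-multiset of `B`. -/
def IsMatching (A B : Multiset (ℝ × WithTop ℝ))
    (σ : Multiset ((ℝ × WithTop ℝ) × (ℝ × WithTop ℝ))) : Prop :=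
  σ.map Prod.fst ≤ A ∧ σ.map Prod.snd ≤ B

open Classical in
/-- The cost of a matching: the largest of the costs of its matched pairs and of the distances to
the diagonal of the unmatched points (and `0` if there are no points at all). -/
noncomputable def matchingCost (A B : Multiset (ℝ × WithTop ℝ))
    (σ : Multiset ((ℝ × WithTop ℝ) × (ℝ × WithTop ℝ))) : ℝ≥0∞ :=
  max (σ.map fun pq => pairCost pq.1 pq.2).sup
    (max ((A - σ.map Prod.fst).map diagCost).sup ((B - σ.map Prod.snd).map diagCost).sup)

/-- The bottleneck distance of two diagrams. -/
noncomputable def bottleneck (A B : Multiset (ℝ × WithTop ℝ)) : ℝ≥0∞ :=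
  ⨅ (σ : Multiset ((ℝ × WithTop ℝ) × (ℝ × WithTop ℝ))) (_ : IsMatching A B σ),
    matchingCost A B σ

/-! ## Lines of positive slope -/

/-- A line of positive slope, given by its unique parametrization `s ↦ s m + b` that satisfies the
standard normalization `max mᵢ = 1`, `b₀ + b₁ = 0`. -/
structure PosLine where
  m : Plane
  b : Plane
  m_pos : ∀ i, 0 < m i
  m_max : max (m 0) (m 1) = 1
  b_sum : b 0 + b 1 = 0

namespace PosLine

/-- The point of the line with parameter `s`. -/
def pt (L : PosLine) (s : ℝ) : Plane := s • L.m + L.b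

theorem pt_mono (L : PosLine) {s t : ℝ} (h : s ≤ t) : L.pt s ≤ L.pt t := by
  intro i
  simpa [pt] using mul_le_mul_of_nonneg_right h (L.m_pos i).le

theorem m_ne_zero (L : PosLine) : L.m ≠ 0 := fun h => by
  have := L.m_pos 0
  simp [h] at this

/-- The line as a subset of the plane. -/
def carrier (L : PosLine) : Set Plane := Set.range L.pt

/-- The weight of the line: the smaller coordinate of its direction vector. -/
noncomputable def weight (L : PosLine) : ℝ := min (L.m 0) (L.m 1)

/-- The parameter value of the push of `u` onto the line; see `carrier_inter_frontier`. -/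
noncomputable def pushParam (L : PosLine) (u : Plane) : ℝ :=
  max ((u 0 - L.b 0) / L.m 0) ((u 1 - L.b 1) / L.m 1)

/-- The line meets the boundary of the positive cone of `u` exactly in the point with parameter
`pushParam L u`. -/
theorem carrier_inter_frontier (L : PosLine) (u : Plane) :
    L.carrier ∩ frontier (Set.Ici u) = {L.pt (L.pushParam u)} := by
  have h0 := L.m_pos 0
  have h1 := L.m_pos 1
  have hfr : ∀ x : Plane, x ∈ frontier (Set.Ici u) ↔
      (u 0 ≤ x 0 ∧ u 1 ≤ x 1) ∧ ¬ (u 0 < x 0 ∧ u 1 < x 1) := by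
    intro x
    have hint : interior (Set.Ici u) = Set.pi Set.univ fun i => Set.Ioi (u i) := by
      rw [← Set.pi_univ_Ici, interior_pi_set Set.finite_univ]
      simp
    rw [isClosed_Ici.frontier_eq, hint]
    simp [Pi.le_def, Fin.forall_fin_two]
  have key : ∀ s : ℝ, L.pt s ∈ frontier (Set.Ici u) ↔ s = L.pushParam u := by
    intro s
    rw [hfr]
    have e : ∀ i, L.pt s i = s * L.m i + L.b i := fun i => by simp [pt]
    have a0 : u 0 ≤ L.pt s 0 ↔ (u 0 - L.b 0) / L.m 0 ≤ s := by
      rw [e, div_le_iff₀ h0]; constructor <;> intro h <;> linarith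
    have a1 : u 1 ≤ L.pt s 1 ↔ (u 1 - L.b 1) / L.m 1 ≤ s := by
      rw [e, div_le_iff₀ h1]; constructor <;> intro h <;> linarith
    have c0 : u 0 < L.pt s 0 ↔ (u 0 - L.b 0) / L.m 0 < s := by
      rw [e, div_lt_iff₀ h0]; constructor <;> intro h <;> linarith
    have c1 : u 1 < L.pt s 1 ↔ (u 1 - L.b 1) / L.m 1 < s := by
      rw [e, div_lt_iff₀ h1]; constructor <;> intro h <;> linarith
    rw [a0, a1, c0, c1, pushParam, ← max_le_iff, ← max_lt_iff, not_lt]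
    exact ⟨fun h => le_antisymm h.2 h.1, fun h => ⟨h.ge, h.le⟩⟩
  ext x
  constructor
  · rintro ⟨⟨s, rfl⟩, hx⟩
    rw [(key s).1 hx]; rfl
  · rintro rfl
    exact ⟨⟨_, rfl⟩, (key _).2 rfl⟩

end PosLine

/-- The restriction `M^L` of a two-parameter module to a line of positive slope. -/
def PersistenceModule.restrict {F : Type u} [Field F] (M : PersistenceModule.{u, w} F Plane)
    (L : PosLine) : PersistenceModule.{u, w} F ℝ where
  obj s := M.obj (L.pt s)
  map h := M.map (L.pt_mono h)
  map_refl s := M.map_refl (L.pt s)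
  map_trans hpq hqr := M.map_trans (L.pt_mono hpq) (L.pt_mono hqr)

/-- The weighted bottleneck distance of `M` and `N` along the line `L`. -/
noncomputable def weightedDist {F : Type u} [Field F] (M : PersistenceModule.{u, w₁} F Plane)
    (N : PersistenceModule.{u, w₂} F Plane) (L : PosLine) : ℝ≥0∞ :=
  ENNReal.ofReal L.weight * bottleneck (M.restrict L).dgm (N.restrict L).dgm

/-! ## The projective plane and the equivalence of lines -/

/-- The projective completion of the plane. -/
abbrev ProjPlane : Type := ℙ ℝ (Fin 3 → ℝ)

/-- The proper point `[1 : u₀ : u₁]`. -/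
noncomputable def proper (u : Plane) : ProjPlane :=
  Projectivization.mk ℝ ![1, u 0, u 1] fun h => by simpa using congrFun h 0

/-- The point `[0 : v₀ : v₁]` of the line at infinity. -/
noncomputable def atInfinity (v : Plane) (hv : v ≠ 0) : ProjPlane :=
  Projectivization.mk ℝ ![0, v 0, v 1] fun h => hv <| by
    ext i
    fin_cases i
    · simpa using congrFun h 1
    · simpa using congrFun h 2

/-- The point `[0 : 1 : 1]`, the direction of the diagonal lines. -/
noncomputable def diagonalPoint : ProjPlane :=
  atInfinity (fun _ => 1) fun h => by simpa using congrFun h 0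

/-- The set of points of the projective plane on the line: its proper points and its direction. -/
def PosLine.projCarrier (L : PosLine) : Set ProjPlane :=
  proper '' L.carrier ∪ {atInfinity L.m L.m_ne_zero}

/-- The pairs of real numbers that agree with `u` in the coordinates in `A`, and are larger than
`u` in the other ones. -/
def openFace (A : Set (Fin 2)) (u : Plane) : Set Plane :=
  {x | ∀ i, (i ∈ A → x i = u i) ∧ (i ∉ A → u i < x i)}

/-- The open faces `S_A(p)`, for the proper points `p = [1 : u₀ : u₁]` and for the points at
infinity `p = [0 : v₀ : v₁]` with `v₀, v₁ > 0`.  For the other points at infinity, through which no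
line of positive slope passes, the faces are empty. -/
def projFace (A : Set (Fin 2)) (p : ProjPlane) : Set ProjPlane :=
  {q | (∃ u x : Plane, p = proper u ∧ q = proper x ∧ x ∈ openFace A u) ∨
    (∃ (v x : Plane) (hv : v ≠ 0) (hx : x ≠ 0), (∀ i, 0 < v i) ∧
      p = atInfinity v hv ∧ q = atInfinity x hx ∧ x ∈ openFace A v)}

/-- The reciprocal position `A^L_p`: the largest subset `A` of the set of coordinates, among the
nonempty ones, for which the line meets the face `S_A(p)`. -/
def PosLine.position (L : PosLine) (p : ProjPlane) : Set (Fin 2) :=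
  ⋃₀ {A | A.Nonempty ∧ (L.projCarrier ∩ projFace A p).Nonempty}

/-- The lines have the same reciprocal position with respect to all the points of `U`. -/
def PosLine.Equivalent (U : Set ProjPlane) (L L' : PosLine) : Prop :=
  ∀ p ∈ U, L.position p = L'.position p

/-! ## The properties (P) and (Q), and the cost of vertical and horizontal lines -/

/-- Property (P) for the finite set `C` of critical values: with `closure C` the closure of `C`
under least upper bounds, the rank of the transition map from `p` to `q` is the rank of the one
from `p'` to `q'`, the largest elements of `closure C` below `p` and `q`, and it is zero if there
is no element of `closure C` below `p`. -/
def PropertyP {F : Type u} [Field F] (M : PersistenceModule.{u, w} F Plane) (C : Set Plane) :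
    Prop :=
  C.Finite ∧ ∀ (p q : Plane) (h : p ≤ q),
    (∀ (p' q' : Plane) (h' : p' ≤ q'), IsGreatest {c ∈ supClosure C | c ≤ p} p' →
      IsGreatest {c ∈ supClosure C | c ≤ q} q' → M.rank h = M.rank h') ∧
    ({c ∈ supClosure C | c ≤ p} = ∅ → M.rank h = 0)

/-- Property (Q) for the finite set `Ω` of switch points, where `K` is the set of all critical
values. -/
def PropertyQ (K : Set Plane) (Ω : Set ProjPlane) : Prop :=
  Ω.Finite ∧ ∀ c₁ ∈ K, ∀ c₂ ∈ K, ∀ c₃ ∈ K, ∀ c₄ ∈ K,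
    ∀ δ ∈ ({1, 2} : Set ℝ), ∀ η ∈ ({1, 2} : Set ℝ),
    ∀ L L' : PosLine, PosLine.Equivalent (proper '' K ∪ Ω) L L' →
      SignType.sign (|L.pushParam c₁ - L.pushParam c₂| / δ
          - |L.pushParam c₃ - L.pushParam c₄| / η) =
        SignType.sign (|L'.pushParam c₁ - L'.pushParam c₂| / δ
          - |L'.pushParam c₃ - L'.pushParam c₄| / η)

/-- `κ` is the cost of the line `{r | r i = a}`, which is vertical for `i = 0` and horizontal for
`i = 1`: for every point `r` of it, `κ` is the limit of the weighted bottleneck distance along the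
lines of positive slope through `r`, as the coordinate `mᵢ` of their (normalized) direction tends
to zero. -/
def IsAxisCost {F : Type u} [Field F] (M : PersistenceModule.{u, w₁} F Plane)
    (N : PersistenceModule.{u, w₂} F Plane) (i : Fin 2) (a : ℝ) (κ : ℝ≥0∞) : Prop :=
  ∀ r : Plane, r i = a →
    Tendsto (weightedDist M N)
      (comap (fun L : PosLine => L.m i) (𝓝[>] 0) ⊓ 𝓟 {L | r ∈ L.carrier}) (𝓝 κ)

end MatchingDistance

namespace MatchingDistance
universe u w w₁ w₂

/-! ## The bottleneck distance through splittings -/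

section Bottleneck

/-! Let `j` be the coordinate other than `i`. A line of positive slope with `m j = 1` is `x i = μ *
x j + c` with `0 < μ ≤ 1`, and its weight is `μ`. Multiplying the push parameter of `u` by the
weight and shifting it gives `max (u i) (μ * u j + c)`, which is `lineFn` (`PosLine.lineFn_eq`).
This expression still makes sense at `μ = 0`, where it describes the axis-parallel line `x i = c`.
The cost of that line is therefore the bottleneck distance of the barcodes obtained by placing each
critical value `u` at `max (u i) c`.

Barcodes along an arbitrary sup-preserving placement are handled through ranks. By (P), bar counts
are ranks of maps between critical values, and bar counts determine a diagram off the diagonal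
(`IsBarcode.offDiag_eq`), where alone the bottleneck distance sees it. Bars can be labelled by
critical values, and the labelling stays valid while the weak order of the placed values is
respected (`exists_symbolic`). For fixed labels the distance is a finite minimum of maxima of terms
`|g u - g v| / k`, hence continuous in the placement `g`. This gives the limit
(`tendsto_weightedDist`, `isAxisCost_of_costAt`).

For the inequality, let `W` be the finite set of proper critical values and switch points. Lines of
small `μ` that separate `W` strictly, as the line `x i = a` does with its own points counted to the
right, are all equivalent. By (Q) a single term gives the cost on all of them and, by continuity, on
the closed cell of weakly separating lines with `μ ≤ μ₁`, where `μ₁` is the first slope at which the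
cell may degenerate. This cell contains `x i = a` and also a special line of slope parameter `μ₁`
(`exists_cell`).

On the cell a point `u` to the right keeps the constant value `u i`. If the term is zero, infinite,
or involves two right points, it is no larger at the special line. Otherwise it pairs a right point
with a left one. Moving the axis-parallel line left to the next point of `W` stays in the cell and
increases the term, so induction on the number of points to the left finishes the proof
(`exists_special_ge`). -/

theorem extDist_comm (x y : WithTop ℝ) : extDist x y = extDist y x := by
  induction x using WithTop.recTopCoe <;> induction y using WithTop.recTopCoe
  · rfl
  · rfl
  · rfl
  · exact congrArg ENNReal.ofReal (abs_sub_comm _ _)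

@[simp] theorem extDist_coe (x y : ℝ) : extDist (x : WithTop ℝ) y = ENNReal.ofReal |x - y| := rfl
@[simp] theorem extDist_top_top : extDist ⊤ ⊤ = 0 := rfl
@[simp] theorem extDist_coe_top (x : ℝ) : extDist (x : WithTop ℝ) ⊤ = ∞ := rfl
@[simp] theorem extDist_top_coe (x : ℝ) : extDist ⊤ (x : WithTop ℝ) = ∞ := rfl

theorem extDist_self (x : WithTop ℝ) : extDist x x = 0 := by
  induction x using WithTop.recTopCoe <;> simp

theorem extDist_triangle (x y z : WithTop ℝ) : extDist x z ≤ extDist x y + extDist y z := by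
  induction x using WithTop.recTopCoe <;> induction y using WithTop.recTopCoe <;>
    induction z using WithTop.recTopCoe <;> simp
  rw [← ENNReal.ofReal_add (abs_nonneg _) (abs_nonneg _)]
  exact ENNReal.ofReal_le_ofReal (abs_sub_le _ _ _)

theorem pairCost_comm (p q : ℝ × WithTop ℝ) : pairCost p q = pairCost q p := by
  simp only [pairCost]; rw [extDist_comm, extDist_comm p.2]

theorem diagCost_eq_zero {z : ℝ × WithTop ℝ} (hz : (z.1 : WithTop ℝ) = z.2) : diagCost z = 0 := by
  simp [diagCost, hz, extDist_self]

/-- Triangle inequality through the common coordinate of `z`. Unmatching a point from a diagonal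
point thus never raises the cost. -/
theorem diagCost_le_pairCost {z q : ℝ × WithTop ℝ} (hz : (z.1 : WithTop ℝ) = z.2) :
    diagCost q ≤ pairCost z q := by
  have h : extDist q.1 q.2 ≤ extDist z.1 q.1 + extDist z.2 q.2 := by
    rw [extDist_comm z.1 q.1, ← hz]
    exact extDist_triangle _ _ _
  unfold diagCost pairCost
  refine ENNReal.div_le_of_le_mul (h.trans ?_)
  rw [mul_two]
  exact add_le_add (le_max_left _ _) (le_max_right _ _)

theorem sup_map_le {X : Type*} {m : Multiset X} {f : X → ℝ≥0∞} {r : ℝ≥0∞} :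
    (m.map f).sup ≤ r ↔ ∀ x ∈ m, f x ≤ r := by
  rw [Multiset.sup_le]
  exact Multiset.forall_mem_map_iff

/-- The cost of a splitting of two diagrams into matched pairs and unmatched points. -/
noncomputable def splitCost (σ : Multiset ((ℝ × WithTop ℝ) × (ℝ × WithTop ℝ)))
    (R R' : Multiset (ℝ × WithTop ℝ)) : ℝ≥0∞ :=
  max (σ.map fun pq => pairCost pq.1 pq.2).sup
    (max (R.map diagCost).sup (R'.map diagCost).sup)

theorem splitCost_le {σ : Multiset ((ℝ × WithTop ℝ) × (ℝ × WithTop ℝ))}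
    {R R' : Multiset (ℝ × WithTop ℝ)} {r : ℝ≥0∞} :
    splitCost σ R R' ≤ r ↔ (∀ x ∈ σ, pairCost x.1 x.2 ≤ r) ∧ (∀ x ∈ R, diagCost x ≤ r) ∧
      ∀ x ∈ R', diagCost x ≤ r := by
  simp only [splitCost, max_le_iff, sup_map_le]

theorem matchingCost_add (σ : Multiset ((ℝ × WithTop ℝ) × (ℝ × WithTop ℝ)))
    (R R' : Multiset (ℝ × WithTop ℝ)) :
    matchingCost (σ.map Prod.fst + R) (σ.map Prod.snd + R') σ = splitCost σ R R' := by
  simp only [matchingCost, splitCost, add_tsub_cancel_left]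

theorem bottleneck_le (σ : Multiset ((ℝ × WithTop ℝ) × (ℝ × WithTop ℝ)))
    (R R' : Multiset (ℝ × WithTop ℝ)) :
    bottleneck (σ.map Prod.fst + R) (σ.map Prod.snd + R') ≤ splitCost σ R R' := by
  rw [← matchingCost_add]
  exact iInf₂_le σ ⟨Multiset.le_add_right _ _, Multiset.le_add_right _ _⟩

theorem le_bottleneck {A B : Multiset (ℝ × WithTop ℝ)} {r : ℝ≥0∞}
    (h : ∀ σ R R', A = σ.map Prod.fst + R → B = σ.map Prod.snd + R' → r ≤ splitCost σ R R') :
    r ≤ bottleneck A B := by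
  refine le_iInf₂ fun σ hσ => ?_
  obtain ⟨R, rfl⟩ := Multiset.le_iff_exists_add.1 hσ.1
  obtain ⟨R', rfl⟩ := Multiset.le_iff_exists_add.1 hσ.2
  rw [matchingCost_add]
  exact h σ R R' rfl rfl

theorem bottleneck_comm_le (A B : Multiset (ℝ × WithTop ℝ)) :
    bottleneck A B ≤ bottleneck B A := by
  refine le_bottleneck fun σ R R' hA hB => ?_
  have h := bottleneck_le (σ.map Prod.swap) R' R
  simp only [Multiset.map_map, Function.comp_def, Prod.fst_swap, Prod.snd_swap] at h
  have hA' : B = σ.map (fun x => x.1) + R := hA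
  have hB' : A = σ.map (fun x => x.2) + R' := hB
  rw [hA', hB']
  refine h.trans (splitCost_le.2 ?_)
  have := splitCost_le.1 (le_refl (splitCost σ R R'))
  refine ⟨fun x hx => ?_, this.2.2, this.2.1⟩
  obtain ⟨y, hy, rfl⟩ := Multiset.mem_map.1 hx
  exact (pairCost_comm _ _).trans_le (this.1 y hy)

theorem bottleneck_comm (A B : Multiset (ℝ × WithTop ℝ)) : bottleneck A B = bottleneck B A :=
  le_antisymm (bottleneck_comm_le _ _) (bottleneck_comm_le _ _)

/-- A diagonal point costs nothing when unmatched, and its partner in a matching may be left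
unmatched instead. Bars that shrink to points under a limit of placements are harmless for this
reason. -/
theorem bottleneck_cons {z : ℝ × WithTop ℝ} (hz : (z.1 : WithTop ℝ) = z.2)
    (A B : Multiset (ℝ × WithTop ℝ)) : bottleneck (z ::ₘ A) B = bottleneck A B := by
  apply le_antisymm
  · refine le_bottleneck fun σ R R' hA hB => ?_
    have h := bottleneck_le σ (z ::ₘ R) R'
    rw [Multiset.add_cons, ← hA, ← hB] at h
    refine h.trans (splitCost_le.2 ?_)
    have := splitCost_le.1 (le_refl (splitCost σ R R'))
    refine ⟨this.1, fun x hx => ?_, this.2.2⟩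
    rcases Multiset.mem_cons.1 hx with rfl | hx
    · simp [diagCost_eq_zero hz]
    · exact this.2.1 x hx
  · refine le_bottleneck fun σ R R' hA hB => ?_
    have hmem : z ∈ σ.map Prod.fst + R := hA ▸ Multiset.mem_cons_self _ _
    have this := splitCost_le.1 (le_refl (splitCost σ R R'))
    rcases Multiset.mem_add.1 hmem with hm | hm
    · obtain ⟨y, hy, hyz⟩ := Multiset.mem_map.1 hm
      obtain ⟨τ, rfl⟩ := Multiset.exists_cons_of_mem hy
      simp only [Multiset.map_cons, Multiset.cons_add, hyz] at hA hB
      have hA' := (Multiset.cons_inj_right _).1 hA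
      rw [← Multiset.add_cons] at hB
      rw [hA', hB]
      refine (bottleneck_le _ _ _).trans (splitCost_le.2 ⟨fun x hx => ?_, this.2.1, fun x hx => ?_⟩)
      · exact this.1 x (Multiset.mem_cons_of_mem hx)
      · rcases Multiset.mem_cons.1 hx with rfl | hx
        · refine le_trans ?_ (this.1 y (Multiset.mem_cons_self _ _))
          rw [hyz]; exact diagCost_le_pairCost hz
        · exact this.2.2 x hx
    · obtain ⟨Q, rfl⟩ := Multiset.exists_cons_of_mem hm
      rw [Multiset.add_cons] at hA
      rw [(Multiset.cons_inj_right _).1 hA, hB]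
      exact (bottleneck_le _ _ _).trans (splitCost_le.2
        ⟨this.1, fun x hx => this.2.1 x (Multiset.mem_cons_of_mem hx), this.2.2⟩)

theorem bottleneck_add_left {Z : Multiset (ℝ × WithTop ℝ)}
    (hZ : ∀ z ∈ Z, (z.1 : WithTop ℝ) = z.2) (A B : Multiset (ℝ × WithTop ℝ)) :
    bottleneck (Z + A) B = bottleneck A B := by
  induction Z using Multiset.induction_on with
  | empty => simp
  | cons z Z ih =>
    rw [Multiset.cons_add, bottleneck_cons (hZ z (Multiset.mem_cons_self _ _)),
      ih fun x hx => hZ x (Multiset.mem_cons_of_mem hx)]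

open Classical in
/-- The points of a diagram off the diagonal. -/
noncomputable def offDiag (D : Multiset (ℝ × WithTop ℝ)) : Multiset (ℝ × WithTop ℝ) :=
  D.filter fun I => (I.1 : WithTop ℝ) < I.2

theorem bottleneck_offDiag_left {A : Multiset (ℝ × WithTop ℝ)}
    (hA : ∀ I ∈ A, (I.1 : WithTop ℝ) ≤ I.2) (B : Multiset (ℝ × WithTop ℝ)) :
    bottleneck (offDiag A) B = bottleneck A B := by
  classical
  conv_rhs => rw [← Multiset.filter_add_not (fun I : ℝ × WithTop ℝ => (I.1 : WithTop ℝ) < I.2) A,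
    add_comm]
  rw [bottleneck_add_left]
  · unfold offDiag; congr!
  · intro z hz
    obtain ⟨h1, h2⟩ := Multiset.mem_filter.1 hz
    exact le_antisymm (hA z h1) (not_lt.1 h2)

theorem bottleneck_congr_offDiag {A A' B B' : Multiset (ℝ × WithTop ℝ)}
    (hA : ∀ I ∈ A, (I.1 : WithTop ℝ) ≤ I.2) (hA' : ∀ I ∈ A', (I.1 : WithTop ℝ) ≤ I.2)
    (hB : ∀ I ∈ B, (I.1 : WithTop ℝ) ≤ I.2) (hB' : ∀ I ∈ B', (I.1 : WithTop ℝ) ≤ I.2)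
    (h : offDiag A = offDiag A') (h' : offDiag B = offDiag B') :
    bottleneck A B = bottleneck A' B' := by
  rw [← bottleneck_offDiag_left hA, ← bottleneck_offDiag_left hA', h, bottleneck_comm,
    ← bottleneck_offDiag_left hB, h', bottleneck_offDiag_left hB', bottleneck_comm]

end Bottleneck

/-! ## Diagrams with symbolic end points -/

section Symbolic

variable {α : Type}

/-- The evaluation of a bar with symbolic end points. -/
def evalBar (g : α → ℝ) (x : α × WithTop α) : ℝ × WithTop ℝ := (g x.1, x.2.map g)

/-- The evaluation of a symbolic term `(x, y, k)`, which stands for `|x - y| / k`. -/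
noncomputable def termValue (g : α → ℝ) (x : WithTop α × WithTop α × ℕ) : ℝ≥0∞ :=
  extDist (x.1.map g) (x.2.1.map g) / x.2.2

/-- The terms that occur in the cost of a splitting, and a vanishing one. -/
def splitTerms (σ : Multiset ((α × WithTop α) × (α × WithTop α)))
    (R R' : Multiset (α × WithTop α)) : Multiset (WithTop α × WithTop α × ℕ) :=
  (⊤, ⊤, 1) ::ₘ (σ.map (fun x => ((x.1.1 : WithTop α), (x.2.1 : WithTop α), 1)) +
    σ.map (fun x => (x.1.2, x.2.2, 1)) + (R.map (fun x => ((x.1 : WithTop α), x.2, 2)) +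
    R'.map (fun x => ((x.1 : WithTop α), x.2, 2))))

theorem splitCost_map (g : α → ℝ) (σ : Multiset ((α × WithTop α) × (α × WithTop α)))
    (R R' : Multiset (α × WithTop α)) :
    splitCost (σ.map (Prod.map (evalBar g) (evalBar g))) (R.map (evalBar g)) (R'.map (evalBar g)) =
      ((splitTerms σ R R').map (termValue g)).sup := by
  refine eq_of_forall_ge_iff fun r => ?_
  simp only [splitCost_le, splitTerms, sup_map_le, Multiset.forall_mem_map_iff, Multiset.mem_cons,
    Multiset.mem_add, or_imp, forall_and, forall_eq]
  simp [termValue, pairCost, diagCost, evalBar, forall_and, and_assoc]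

/-- Preimages are chosen one matched pair at a time, so neither map has to be injective: distinct
labels may have equal values. -/
theorem exists_lift_matching {β γ : Type*} (f : α → β) (f' : γ → β) :
    ∀ (σ : Multiset (β × β)) (A : Multiset α) (B : Multiset γ) (R R' : Multiset β),
      A.map f = σ.map Prod.fst + R → B.map f' = σ.map Prod.snd + R' →
      ∃ (τ : Multiset (α × γ)) (Q : Multiset α) (Q' : Multiset γ),
        A = τ.map Prod.fst + Q ∧ B = τ.map Prod.snd + Q' ∧ σ = τ.map (Prod.map f f') ∧
          R = Q.map f ∧ R' = Q'.map f' := by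
  intro σ
  induction σ using Multiset.induction_on with
  | empty =>
    intro A B R R' hA hB
    exact ⟨0, A, B, by simp, by simp, by simp, by simpa using hA.symm, by simpa using hB.symm⟩
  | cons s σ ih =>
    intro A B R R' hA hB
    rw [Multiset.map_cons, Multiset.cons_add] at hA hB
    obtain ⟨a, ha, hfa⟩ := Multiset.mem_map.1 (hA ▸ Multiset.mem_cons_self _ _ : s.1 ∈ A.map f)
    obtain ⟨b, hb, hfb⟩ := Multiset.mem_map.1 (hB ▸ Multiset.mem_cons_self _ _ : s.2 ∈ B.map f')
    obtain ⟨A, rfl⟩ := Multiset.exists_cons_of_mem ha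
    obtain ⟨B, rfl⟩ := Multiset.exists_cons_of_mem hb
    rw [Multiset.map_cons, hfa, Multiset.cons_inj_right] at hA
    rw [Multiset.map_cons, hfb, Multiset.cons_inj_right] at hB
    obtain ⟨τ, Q, Q', rfl, rfl, rfl, rfl, rfl⟩ := ih A B R R' hA hB
    exact ⟨(a, b) ::ₘ τ, Q, Q', by simp, by simp, by simp [hfa, hfb], rfl, rfl⟩

/-- The terms of all the splittings of two symbolic diagrams. -/
def splittings (A B : Multiset (α × WithTop α)) : Set (Multiset (WithTop α × WithTop α × ℕ)) :=
  {m | ∃ σ R R', A = σ.map Prod.fst + R ∧ B = σ.map Prod.snd + R' ∧ m = splitTerms σ R R'}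

theorem splittings_nonempty (A B : Multiset (α × WithTop α)) : (splittings A B).Nonempty :=
  ⟨_, 0, A, B, by simp, by simp, rfl⟩

theorem splittings_finite (A B : Multiset (α × WithTop α)) : (splittings A B).Finite := by
  classical
  -- A pair occurs in `σ` at most `σ.card ≤ A.card` times, which puts all the matchings below one
  -- fixed multiset.
  have key : ∀ σ : Multiset ((α × WithTop α) × (α × WithTop α)), ∀ R R',
      A = σ.map Prod.fst + R → B = σ.map Prod.snd + R' → σ ≤ A.card • (A ×ˢ B) := by
    intro σ R R' hA hB
    rw [Multiset.le_iff_count]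
    rintro ⟨x, y⟩
    by_cases hxy : (x, y) ∈ σ
    · have hx : x ∈ A := hA ▸ Multiset.mem_add.2 (Or.inl (Multiset.mem_map.2 ⟨_, hxy, rfl⟩))
      have hy : y ∈ B := hB ▸ Multiset.mem_add.2 (Or.inl (Multiset.mem_map.2 ⟨_, hxy, rfl⟩))
      have h1 : σ.card ≤ A.card := by rw [hA]; simp
      have h2 : 1 ≤ (A ×ˢ B).count (x, y) :=
        Multiset.one_le_count_iff_mem.2 (Multiset.mem_product.2 ⟨hx, hy⟩)
      rw [Multiset.count_nsmul]
      exact (Multiset.count_le_card _ _).trans (h1.trans (Nat.le_mul_of_pos_right _ h2))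
    · simp [Multiset.count_eq_zero_of_notMem hxy]
  refine ((Finset.finite_toSet ((A.card • (A ×ˢ B)).powerset.toFinset ×ˢ
    (A.powerset.toFinset ×ˢ B.powerset.toFinset))).image
      fun x => splitTerms x.1 x.2.1 x.2.2).subset ?_
  rintro m ⟨σ, R, R', hA, hB, rfl⟩
  refine ⟨(σ, R, R'), ?_, rfl⟩
  simp only [Finset.coe_product, Set.mem_prod, Finset.mem_coe, Multiset.mem_toFinset,
    Multiset.mem_powerset]
  exact ⟨key σ R R' hA hB, hA ▸ Multiset.le_add_left _ _, hB ▸ Multiset.le_add_left _ _⟩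

/-- The index set of the minimum does not depend on `g`. Continuity in `g` and dependence on the
order of the terms alone can both be read off. -/
theorem bottleneck_map (A B : Multiset (α × WithTop α)) (g : α → ℝ) :
    bottleneck (A.map (evalBar g)) (B.map (evalBar g)) =
      (splittings_finite A B).toFinset.inf fun m => (m.map (termValue g)).sup := by
  apply le_antisymm
  · refine Finset.le_inf fun m hm => ?_
    obtain ⟨σ, R, R', rfl, rfl, rfl⟩ := (splittings_finite A B).mem_toFinset.1 hm
    rw [← splitCost_map]
    refine le_trans (le_of_eq ?_) (bottleneck_le _ _ _)
    simp [Multiset.map_map]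
  · refine le_bottleneck fun σ R R' hA hB => ?_
    obtain ⟨τ, Q, Q', hA', hB', rfl, rfl, rfl⟩ :=
      exists_lift_matching (evalBar g) (evalBar g) σ A B R R' hA hB
    rw [splitCost_map]
    exact Finset.inf_le ((splittings_finite A B).mem_toFinset.2 ⟨τ, Q, Q', hA', hB', rfl⟩)

theorem tendsto_multiset_sup {X ι : Type*} (l : Filter ι) (m : Multiset X) (f : ι → X → ℝ≥0∞)
    (f₀ : X → ℝ≥0∞) (h : ∀ x ∈ m, Tendsto (fun i => f i x) l (𝓝 (f₀ x))) :
    Tendsto (fun i => (m.map (f i)).sup) l (𝓝 (m.map f₀).sup) := by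
  induction m using Multiset.induction_on with
  | empty => simpa using tendsto_const_nhds
  | cons x m ih =>
    simp only [Multiset.map_cons, Multiset.sup_cons]
    exact (h x (Multiset.mem_cons_self _ _)).sup_nhds
      (ih fun y hy => h y (Multiset.mem_cons_of_mem hy))

/-- A minimum of maxima of finitely many terms is attained by a term which depends only on the
order of the terms. -/
theorem exists_minimax {X : Type*} (S : Finset (Multiset X)) (hS : S.Nonempty)
    (hne : ∀ m ∈ S, m ≠ 0) (v : X → ℝ≥0∞) :
    ∃ m ∈ S, ∃ y ∈ m, ∀ w : X → ℝ≥0∞,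
      (∀ a, (∃ m ∈ S, a ∈ m) → ∀ b, (∃ m ∈ S, b ∈ m) → v a ≤ v b → w a ≤ w b) →
      (S.inf fun m => (m.map w).sup) = w y := by
  classical
  have hmax : ∀ m ∈ S, ∃ y ∈ m, ∀ z ∈ m, v z ≤ v y := by
    intro m hm
    obtain ⟨y, hy, h⟩ := Finset.exists_max_image m.toFinset v
      (Multiset.toFinset_nonempty.2 (hne m hm))
    exact ⟨y, Multiset.mem_toFinset.1 hy, fun z hz => h z (Multiset.mem_toFinset.2 hz)⟩
  -- The multiset `m₀` is optimal for `v`, and `y` is its largest term. Both choices remain optimal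
  -- for every `w` that is monotone with respect to `v`.
  obtain ⟨m₀, hm₀, hmin⟩ := Finset.exists_min_image S (fun m => (m.map v).sup) hS
  obtain ⟨y, hy, hyv⟩ := hmax m₀ hm₀
  refine ⟨m₀, hm₀, y, hy, fun w hw => le_antisymm ?_ (Finset.le_inf fun m hm => ?_)⟩
  · refine (Finset.inf_le hm₀).trans (Multiset.sup_le.2 ?_)
    simp only [Multiset.mem_map, forall_exists_index, and_imp, forall_apply_eq_imp_iff₂]
    exact fun z hz => hw z ⟨m₀, hm₀, hz⟩ y ⟨m₀, hm₀, hy⟩ (hyv z hz)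
  · obtain ⟨z, hz, hzv⟩ := hmax m hm
    refine le_trans (hw y ⟨m₀, hm₀, hy⟩ z ⟨m, hm, hz⟩ ?_)
      (Multiset.le_sup (Multiset.mem_map_of_mem w hz))
    refine le_trans (Multiset.le_sup (Multiset.mem_map_of_mem v hy)) ((hmin m hm).trans ?_)
    refine Multiset.sup_le.2 ?_
    simp only [Multiset.mem_map, forall_exists_index, and_imp, forall_apply_eq_imp_iff₂]
    exact hzv

/-- The terms whose entries lie in `K` or are infinite, and whose denominator is `1` or `2`. -/
def termsOn (K : Set α) : Set (WithTop α × WithTop α × ℕ) :=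
  {x | (∀ c : α, x.1 = c → c ∈ K) ∧ (∀ c : α, x.2.1 = c → c ∈ K) ∧ (x.2.2 = 1 ∨ x.2.2 = 2)}

/-- The end points of the bars lie in `K`. -/
def EndpointsIn (A : Multiset (α × WithTop α)) (K : Set α) : Prop :=
  ∀ x ∈ A, x.1 ∈ K ∧ ∀ c : α, x.2 = c → c ∈ K

theorem EndpointsIn.mono {A : Multiset (α × WithTop α)} {K K' : Set α} (h : EndpointsIn A K)
    (hK : K ⊆ K') : EndpointsIn A K' :=
  fun x hx => ⟨hK (h x hx).1, fun c hc => hK ((h x hx).2 c hc)⟩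

theorem mem_termsOn_of_mem_splittings {A B : Multiset (α × WithTop α)} {K : Set α}
    (hA : EndpointsIn A K) (hB : EndpointsIn B K) {m : Multiset (WithTop α × WithTop α × ℕ)}
    (hm : m ∈ splittings A B) {x : WithTop α × WithTop α × ℕ} (hx : x ∈ m) : x ∈ termsOn K := by
  obtain ⟨σ, R, R', rfl, rfl, rfl⟩ := hm
  simp only [splitTerms, Multiset.mem_cons, Multiset.mem_add, Multiset.mem_map] at hx
  have hfst : ∀ y ∈ σ, y.1.1 ∈ K ∧ ∀ c : α, y.1.2 = c → c ∈ K := fun y hy =>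
    hA _ (Multiset.mem_add.2 (Or.inl (Multiset.mem_map_of_mem _ hy)))
  have hsnd : ∀ y ∈ σ, y.2.1 ∈ K ∧ ∀ c : α, y.2.2 = c → c ∈ K := fun y hy =>
    hB _ (Multiset.mem_add.2 (Or.inl (Multiset.mem_map_of_mem _ hy)))
  rcases hx with rfl | ((⟨y, hy, rfl⟩ | ⟨y, hy, rfl⟩) | (⟨y, hy, rfl⟩ | ⟨y, hy, rfl⟩))
  · simp [termsOn]
  · refine ⟨fun c hc => ?_, fun c hc => ?_, Or.inl rfl⟩
    · exact WithTop.coe_injective hc ▸ (hfst y hy).1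
    · exact WithTop.coe_injective hc ▸ (hsnd y hy).1
  · exact ⟨(hfst y hy).2, (hsnd y hy).2, Or.inl rfl⟩
  · have := hA y (Multiset.mem_add.2 (Or.inr hy))
    exact ⟨fun c hc => WithTop.coe_injective hc ▸ this.1, this.2, Or.inr rfl⟩
  · have := hB y (Multiset.mem_add.2 (Or.inr hy))
    exact ⟨fun c hc => WithTop.coe_injective hc ▸ this.1, this.2, Or.inr rfl⟩

/-- The bottleneck distance of symbolic diagrams is given by the same term for all evaluations that
order the terms compatibly. -/
theorem exists_term_bottleneck {A B : Multiset (α × WithTop α)} {K : Set α}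
    (hA : EndpointsIn A K) (hB : EndpointsIn B K) (g₀ : α → ℝ) :
    ∃ y ∈ termsOn K, ∀ g : α → ℝ,
      (∀ a ∈ termsOn K, ∀ b ∈ termsOn K, termValue g₀ a ≤ termValue g₀ b →
        termValue g a ≤ termValue g b) →
      bottleneck (A.map (evalBar g)) (B.map (evalBar g)) = termValue g y := by
  have hmem : ∀ m ∈ (splittings_finite A B).toFinset, m ∈ splittings A B :=
    fun m hm => (splittings_finite A B).mem_toFinset.1 hm
  obtain ⟨m, hm, y, hy, h⟩ := exists_minimax (splittings_finite A B).toFinset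
    ((splittings_finite A B).toFinset_nonempty.2 (splittings_nonempty A B))
    (fun m hm h0 => by
      obtain ⟨σ, R, R', -, -, rfl⟩ := hmem m hm
      exact Multiset.cons_ne_zero h0) (termValue g₀)
  refine ⟨y, mem_termsOn_of_mem_splittings hA hB (hmem m hm) hy, fun g hg => ?_⟩
  rw [bottleneck_map]
  refine h _ ?_
  rintro a ⟨m₁, h₁, ha⟩ b ⟨m₂, h₂, hb⟩
  exact hg a (mem_termsOn_of_mem_splittings hA hB (hmem _ h₁) ha) b
    (mem_termsOn_of_mem_splittings hA hB (hmem _ h₂) hb)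

theorem tendsto_termValue {ι : Type*} {l : Filter ι} {g : ι → α → ℝ} {g₀ : α → ℝ} {K : Set α}
    (h : ∀ c ∈ K, Tendsto (fun i => g i c) l (𝓝 (g₀ c))) {x : WithTop α × WithTop α × ℕ}
    (hx : x ∈ termsOn K) : Tendsto (fun i => termValue (g i) x) l (𝓝 (termValue g₀ x)) := by
  obtain ⟨x, y, k⟩ := x
  obtain ⟨hx, hy, hk⟩ := hx
  have hk0 : (k : ℝ≥0∞) ≠ 0 := by rcases hk with rfl | rfl <;> simp
  unfold termValue
  refine ENNReal.Tendsto.div_const ?_ (Or.inr hk0)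
  simp only at hx hy ⊢
  induction x using WithTop.recTopCoe with
  | top =>
    induction y using WithTop.recTopCoe with
    | top => exact tendsto_const_nhds
    | coe y => exact tendsto_const_nhds
  | coe x =>
    induction y using WithTop.recTopCoe with
    | top => exact tendsto_const_nhds
    | coe y =>
      simp only [WithTop.map_coe, extDist_coe]
      exact ENNReal.tendsto_ofReal (((h x (hx x rfl)).sub (h y (hy y rfl))).abs)

theorem tendsto_bottleneck_map {A B : Multiset (α × WithTop α)} {K : Set α}
    (hA : EndpointsIn A K) (hB : EndpointsIn B K) {ι : Type*} {l : Filter ι} {g : ι → α → ℝ}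
    {g₀ : α → ℝ} (h : ∀ c ∈ K, Tendsto (fun i => g i c) l (𝓝 (g₀ c))) :
    Tendsto (fun i => bottleneck (A.map (evalBar (g i))) (B.map (evalBar (g i)))) l
      (𝓝 (bottleneck (A.map (evalBar g₀)) (B.map (evalBar g₀)))) := by
  simp only [bottleneck_map]
  refine Tendsto.finset_inf_nhds_apply fun m hm => ?_
  exact tendsto_multiset_sup l m _ _ fun x hx => tendsto_termValue h
    (mem_termsOn_of_mem_splittings hA hB ((splittings_finite A B).mem_toFinset.1 hm) hx)

end Symbolic


/-! ## Interval decompositions of tame one-parameter modules -/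

namespace PersistenceModule

section Decomposition

variable {F : Type u} [Field F]

theorem map_map {P : Type} [Preorder P] (X : PersistenceModule.{u, w} F P) {p q r : P}
    (hpq : p ≤ q) (hqr : q ≤ r) (x : X.obj p) :
    X.map hqr (X.map hpq x) = X.map (hpq.trans hqr) x :=
  LinearMap.congr_fun (X.map_trans hpq hqr) x

theorem map_self {P : Type} [Preorder P] (X : PersistenceModule.{u, w} F P) {p : P}
    (h : p ≤ p) (x : X.obj p) : X.map h x = x :=
  LinearMap.congr_fun (X.map_refl p) x

/-- The transition maps are bijective away from the finite set `T`, and the module vanishes to the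
left of `T`. -/
def Tame (X : PersistenceModule.{u, w} F ℝ) (T : Finset ℝ) : Prop :=
  (∀ (s t : ℝ) (h : s ≤ t), (∀ τ ∈ T, τ ≤ t → τ ≤ s) → Function.Bijective (X.map h)) ∧
    ∀ s : ℝ, (∀ τ ∈ T, s < τ) → Subsingleton (X.obj s)

/-- A family of vectors and functionals that splits an interval module off. -/
structure Splitting (X : PersistenceModule.{u, w} F ℝ) (I : ℝ × WithTop ℝ) where
  vec : ∀ t, X.obj t
  fn : ∀ t, X.obj t →ₗ[F] F
  map_vec : ∀ {s t : ℝ} (h : s ≤ t), InInterval I s → InInterval I t → X.map h (vec s) = vec t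
  map_vec_zero : ∀ {s t : ℝ} (h : s ≤ t), InInterval I s → ¬ InInterval I t →
    X.map h (vec s) = 0
  fn_map : ∀ {s t : ℝ} (h : s ≤ t), InInterval I t → ∀ y, fn t (X.map h y) = fn s y
  fn_zero : ∀ t, ¬ InInterval I t → fn t = 0
  fn_vec : ∀ t, InInterval I t → fn t (vec t) = 1

/-! ### Splitting off one interval summand. -/

namespace Splitting

variable {X : PersistenceModule.{u, w} F ℝ} {I : ℝ × WithTop ℝ} (S : X.Splitting I)

theorem fn_map_eq_zero {s t : ℝ} (h : s ≤ t) {y : X.obj s} (hy : S.fn s y = 0) :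
    S.fn t (X.map h y) = 0 := by
  by_cases ht : InInterval I t
  · rw [S.fn_map h ht, hy]
  · rw [S.fn_zero t ht]; rfl

/-- The complement of the interval module. -/
noncomputable def complement : PersistenceModule.{u, w} F ℝ where
  obj t := LinearMap.ker (S.fn t)
  map {s t} h := (X.map h).restrict fun _ hy => S.fn_map_eq_zero h hy
  map_refl t := by
    ext y
    exact X.map_self _ _
  map_trans hpq hqr := by
    ext y
    exact X.map_map hpq hqr _

theorem sub_mem_ker (t : ℝ) (y : X.obj t) : y - S.fn t y • S.vec t ∈ LinearMap.ker (S.fn t) := by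
  by_cases ht : InInterval I t
  · simp [S.fn_vec t ht]
  · simp [S.fn_zero t ht]

/-- The splitting of the space of the module at `t`. -/
noncomputable def equiv (t : ℝ) :
    X.obj t ≃ₗ[F] (interval F I).obj t × S.complement.obj t where
  toFun y := (⟨S.fn t y, fun ht => by simp [S.fn_zero t ht]⟩, ⟨_, S.sub_mem_ker t y⟩)
  map_add' x y := by
    refine Prod.ext (Subtype.ext (map_add _ _ _)) (Subtype.ext ?_)
    change x + y - S.fn t (x + y) • S.vec t = (x - _) + (y - _)
    rw [map_add, add_smul]; abel
  map_smul' c y := by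
    refine Prod.ext (Subtype.ext (map_smul _ _ _)) (Subtype.ext ?_)
    change c • y - S.fn t (c • y) • S.vec t = c • (y - _)
    rw [map_smul, smul_sub, smul_eq_mul, mul_smul]
  invFun z := z.1.1 • S.vec t + z.2.1
  left_inv y := by simp
  right_inv z := by
    have hz : S.fn t z.2.1 = 0 := z.2.2
    have h : S.fn t (z.1.1 • S.vec t + z.2.1) = z.1.1 := by
      rw [map_add, hz, add_zero, map_smul]
      by_cases ht : InInterval I t
      · simp [S.fn_vec t ht]
      · simp [z.1.2 ht]
    refine Prod.ext (Subtype.ext h) (Subtype.ext ?_)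
    change z.1.1 • S.vec t + z.2.1 - S.fn t (z.1.1 • S.vec t + z.2.1) • S.vec t = z.2.1
    rw [h]; abel

theorem equiv_map {s t : ℝ} (h : s ≤ t) (y : X.obj s) :
    S.equiv t (X.map h y) =
      ((interval F I).map h (S.equiv s y).1, S.complement.map h (S.equiv s y).2) := by
  refine Prod.ext (Subtype.ext ?_) (Subtype.ext ?_)
  · change S.fn t (X.map h y) = _
    by_cases ht : InInterval I t
    · simp only [interval, ht, if_true]
      exact S.fn_map h ht y
    · simp only [interval, ht, if_false, S.fn_zero t ht]
      rfl
  · change X.map h y - S.fn t (X.map h y) • S.vec t = X.map h (y - S.fn s y • S.vec s)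
    rw [map_sub, map_smul]
    congr 1
    by_cases hs : InInterval I s
    · by_cases ht : InInterval I t
      · rw [S.fn_map h ht, S.map_vec h hs ht]
      · rw [S.map_vec_zero h hs ht, S.fn_zero t ht]; simp
    · by_cases ht : InInterval I t
      · rw [S.fn_map h ht, S.fn_zero s hs]; simp
      · rw [S.fn_zero t ht, S.fn_zero s hs]; simp

theorem isomorphic_cons {n : ℕ} {J : Fin n → ℝ × WithTop ℝ}
    (h : S.complement.Isomorphic (directSum fun j => interval F (J j))) :
    X.Isomorphic (directSum fun j => interval F (Fin.cons (α := fun _ => ℝ × WithTop ℝ) I J j)) := by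
  obtain ⟨e, he⟩ := h
  refine ⟨fun t => (S.equiv t).trans (((LinearEquiv.refl F _).prodCongr (e t)).trans
    (Fin.consLinearEquiv F fun j : Fin (n + 1) =>
      (interval F (Fin.cons (α := fun _ => ℝ × WithTop ℝ) I J j)).obj t)), ?_⟩
  intro s t h y
  refine funext fun j => ?_
  have h1 := S.equiv_map h y
  have h2 := he s t h (S.equiv s y).2
  refine Fin.cases ?_ (fun j => ?_) j
  · exact congrArg Prod.fst h1
  · have h3 := congrArg (e t) (congrArg Prod.snd h1)
    exact congrFun (h3.trans h2) j

theorem finite_complement (hX : X.PointwiseFinite) : S.complement.PointwiseFinite := fun t => by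
  have := hX t
  exact inferInstanceAs (Module.Finite F (LinearMap.ker (S.fn t)))

theorem finrank_complement_le (hX : X.PointwiseFinite) (t : ℝ) :
    Module.finrank F (S.complement.obj t) ≤ Module.finrank F (X.obj t) := by
  have := hX t
  exact Submodule.finrank_le (LinearMap.ker (S.fn t))

theorem finrank_complement_lt (hX : X.PointwiseFinite) {t : ℝ} (ht : InInterval I t) :
    Module.finrank F (S.complement.obj t) < Module.finrank F (X.obj t) := by
  have := hX t
  refine Submodule.finrank_lt (s := LinearMap.ker (S.fn t)) fun h => ?_
  have h1 : S.vec t ∈ LinearMap.ker (S.fn t) := h ▸ Submodule.mem_top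
  simp [S.fn_vec t ht] at h1

theorem tame_complement {T : Finset ℝ} (hT : X.Tame T) : S.complement.Tame T := by
  refine ⟨fun s t h hst => ⟨fun y z hyz => ?_, fun y => ?_⟩, fun s hs => ?_⟩
  · exact Subtype.ext ((hT.1 s t h hst).1 (congrArg Subtype.val hyz))
  · obtain ⟨z, hz⟩ := (hT.1 s t h hst).2 y.1
    refine ⟨(S.equiv s z).2, ?_⟩
    have h1 := congrArg Prod.snd (S.equiv_map h z)
    refine h1.symm.trans (Subtype.ext ?_)
    change X.map h z - S.fn t (X.map h z) • S.vec t = y.1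
    have h0 : S.fn t y.1 = 0 := y.2
    rw [hz, h0]; simp
  · have := hT.2 s hs
    exact inferInstanceAs (Subsingleton (LinearMap.ker (S.fn s)))

end Splitting

/-- Push forward to `u`, return to `a` by the inverse isomorphism, and apply `φ`. The result can be
computed at any `v` up to `u` at which the images of `y` and `z` agree. -/
theorem exists_functional (X : PersistenceModule.{u, w} F ℝ) {a t u : ℝ} (hau : a ≤ u)
    (htu : t ≤ u) (hbij : ∀ v (h : a ≤ v), v ≤ u → Function.Bijective (X.map h))
    (φ : X.obj a →ₗ[F] F) :
    ∃ ℓ : X.obj t →ₗ[F] F, ∀ v (hav : a ≤ v) (htv : t ≤ v), v ≤ u → ∀ y z,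
      X.map htv y = X.map hav z → ℓ y = φ z := by
  let e := LinearEquiv.ofBijective (X.map hau) (hbij u hau le_rfl)
  refine ⟨φ ∘ₗ e.symm.toLinearMap ∘ₗ X.map htu, fun v hav htv hvu y z hyz => ?_⟩
  have h := congrArg (X.map hvu) hyz
  rw [map_map, map_map] at h
  have h' : e.symm (X.map htu y) = z := by
    rw [LinearEquiv.symm_apply_eq]; exact h
  simp [h']

/-- Any nonzero vector born at the first nontrivial time `b` spans a summand. Its orbit embeds the
interval module, and a functional equal to one on it, chosen just before its death, is pulled back
to all earlier times. Naturality at times before `b` is automatic because the module vanishes there.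
-/
theorem Tame.exists_splitting {X : PersistenceModule.{u, w} F ℝ} {T : Finset ℝ} (hT : X.Tame T)
    {b : ℝ} (hb : b ∈ T) (hlt : ∀ t < b, Subsingleton (X.obj t)) (hnt : Nontrivial (X.obj b)) :
    ∃ d : WithTop ℝ, (b : WithTop ℝ) < d ∧ Nonempty (X.Splitting (b, d)) := by
  classical
  obtain ⟨x, hx⟩ := exists_ne (0 : X.obj b)
  set D := T.filter fun τ => ∃ h : b ≤ τ, X.map h x = 0 with hD
  -- the death of `x`
  obtain ⟨d, hbd, hlive, hdead⟩ : ∃ d : WithTop ℝ, (b : WithTop ℝ) < d ∧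
      (∀ t (h : b ≤ t), (t : WithTop ℝ) < d → X.map h x ≠ 0) ∧
      (∀ t (h : b ≤ t), d ≤ t → X.map h x = 0) := by
    -- The vector can only die at a point of `T`, since the map from the last point of `T` before
    -- `t` is injective.
    have aux : ∀ t (h : b ≤ t), X.map h x = 0 → ∃ τ ∈ D, τ ≤ t := by
      intro t h h0
      have hne : (T.filter (· ≤ t)).Nonempty := ⟨b, by simp [hb, h]⟩
      obtain ⟨hm1, hm2⟩ := Finset.mem_filter.1 ((T.filter (· ≤ t)).max'_mem hne)
      set τ := (T.filter (· ≤ t)).max' hne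
      have hbτ : b ≤ τ := Finset.le_max' _ _ (by simp [hb, h])
      refine ⟨τ, Finset.mem_filter.2 ⟨hm1, hbτ, ?_⟩, hm2⟩
      apply (hT.1 τ t hm2 fun r hr hrt => Finset.le_max' _ _ (by simp [hr, hrt])).1
      rw [map_map, h0, map_zero]
    rcases D.eq_empty_or_nonempty with h | h
    · refine ⟨⊤, WithTop.coe_lt_top _, fun t ht _ h0 => ?_, fun t _ h => absurd h (by simp)⟩
      obtain ⟨τ, hτ, -⟩ := aux t ht h0
      simp [h] at hτ
    · obtain ⟨-, hbd, h0⟩ := Finset.mem_filter.1 (D.min'_mem h)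
      refine ⟨D.min' h, ?_, fun t ht htd h1 => ?_, fun t ht hdt => ?_⟩
      · refine WithTop.coe_lt_coe.2 (lt_of_le_of_ne hbd fun he => hx ?_)
        have : ∀ c (h : b ≤ c), b = c → X.map h x = 0 → x = 0 := by
          rintro c h rfl h1
          rwa [map_self] at h1
        exact this _ hbd he h0
      · obtain ⟨τ, hτ, hτt⟩ := aux t ht h1
        exact absurd (WithTop.coe_lt_coe.1 htd) (not_lt.2 ((D.min'_le τ hτ).trans hτt))
      · rw [← X.map_map hbd (WithTop.coe_le_coe.1 hdt), h0, map_zero]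
  refine ⟨d, hbd, ?_⟩
  have hne : (T.filter fun τ => ((τ : ℝ) : WithTop ℝ) < d).Nonempty := ⟨b, by simp [hb, hbd]⟩
  obtain ⟨-, had⟩ := Finset.mem_filter.1 (Finset.max'_mem _ hne)
  -- The last point of `T` before the death: from `a` up to `d` all the transition maps are
  -- isomorphisms, so a functional at `a` determines the functionals on the whole interval.
  set a := (T.filter fun τ => ((τ : ℝ) : WithTop ℝ) < d).max' hne
  have hba : b ≤ a := Finset.le_max' _ _ (by simp [hb, hbd])
  have hbij : ∀ v (h : a ≤ v), (v : WithTop ℝ) < d → Function.Bijective (X.map h) :=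
    fun v h hv => hT.1 a v h fun r hr hrv => Finset.le_max' _ _
      (Finset.mem_filter.2 ⟨hr, (WithTop.coe_le_coe.2 hrv).trans_lt hv⟩)
  obtain ⟨φ, hφ⟩ : ∃ φ : X.obj a →ₗ[F] F, φ (X.map hba x) = 1 := by
    have h := hlive a hba had
    by_contra! hcon
    refine h ((Module.forall_dual_apply_eq_zero_iff F _).1 fun φ => ?_)
    by_contra h0
    exact hcon ((φ (X.map hba x))⁻¹ • φ) (by simp [h0])
  have hex : ∀ t, ∃ ℓ : X.obj t →ₗ[F] F, (InInterval (b, d) t → ∀ v (hav : a ≤ v) (htv : t ≤ v),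
      v ≤ max a t → ∀ y z, X.map htv y = X.map hav z → ℓ y = φ z) ∧
      (¬ InInterval (b, d) t → ℓ = 0) := by
    intro t
    by_cases ht : InInterval (b, d) t
    · obtain ⟨ℓ, hℓ⟩ := X.exists_functional (le_max_left a t) (le_max_right a t)
        (fun v h hv => hbij v h ((WithTop.coe_le_coe.2 hv).trans_lt (by
          rcases max_choice a t with h | h <;> rw [h]
          exacts [had, ht.2]))) φ
      exact ⟨ℓ, fun _ => hℓ, fun h => absurd ht h⟩
    · exact ⟨0, fun h => absurd h ht, fun _ => rfl⟩
  choose ℓ hℓ hℓ0 using hex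
  have hmax : ∀ t, InInterval (b, d) t → ((max a t : ℝ) : WithTop ℝ) < d := fun t ht => by
    rcases max_choice a t with h | h <;> rw [h]
    exacts [had, ht.2]
  refine ⟨⟨fun t => if h : b ≤ t then X.map h x else 0, ℓ, ?_, ?_, ?_, hℓ0, ?_⟩⟩
  · intro s t h hs ht
    rw [dif_pos hs.1, dif_pos ht.1, map_map]
  · intro s t h hs ht
    rw [dif_pos hs.1, map_map]
    refine hdead t _ (not_lt.1 fun h1 => ht ⟨hs.1.trans h, h1⟩)
  · intro s t h ht y
    by_cases hs : InInterval (b, d) s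
    · obtain ⟨z, hz⟩ := (hbij _ (le_max_left a t) (hmax t ht)).2
        (X.map (h.trans (le_max_right a t)) y)
      rw [hℓ t ht (max a t) (le_max_left _ _) (le_max_right _ _) le_rfl (X.map h y) z
        (by rw [map_map, hz])]
      obtain ⟨z', hz'⟩ := (hbij _ (le_max_left a s) (hmax s hs)).2 (X.map (le_max_right a s) y)
      rw [hℓ s hs (max a s) (le_max_left _ _) (le_max_right _ _) le_rfl y z' hz'.symm]
      congr 1
      apply (hbij _ (le_max_left a t) (hmax t ht)).1
      have h1 := congrArg (X.map (max_le_max_left a h)) hz'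
      rw [map_map, map_map] at h1
      rw [hz, h1]
    · have hsb : s < b := by
        by_contra hsb
        exact hs ⟨not_lt.1 hsb, (WithTop.coe_le_coe.2 h).trans_lt ht.2⟩
      have := hlt s hsb
      rw [Subsingleton.elim y 0]; simp
  · intro t ht
    rw [dif_pos ht.1, hℓ t ht (max a t) (le_max_left _ _) (le_max_right _ _) le_rfl _
      (X.map hba x) (by rw [map_map, map_map]), hφ]

theorem Tame.subsingleton {X : PersistenceModule.{u, w} F ℝ} {T : Finset ℝ} (hT : X.Tame T) {t : ℝ}
    (h : ∀ τ ∈ T, τ ≤ t → Subsingleton (X.obj τ)) : Subsingleton (X.obj t) := by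
  by_cases hne : (T.filter (· ≤ t)).Nonempty
  · obtain ⟨hm1, hm2⟩ := Finset.mem_filter.1 ((T.filter (· ≤ t)).max'_mem hne)
    have := h _ hm1 hm2
    exact (hT.1 _ t hm2 fun r hr hrt => Finset.le_max' _ _ (by simp [hr, hrt])).2.subsingleton
  · refine hT.2 t fun τ hτ => ?_
    by_contra hτt
    exact hne ⟨τ, by simp [hτ, not_lt.1 hτt]⟩

/-- A tame pointwise finite one-parameter module is a finite direct sum of interval modules. -/
theorem Tame.exists_decomposition {T : Finset ℝ} (k : ℕ) :
    ∀ X : PersistenceModule.{u, w} F ℝ, X.Tame T → X.PointwiseFinite →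
      ∑ τ ∈ T, Module.finrank F (X.obj τ) ≤ k →
      ∃ (n : ℕ) (I : Fin n → ℝ × WithTop ℝ), (∀ j, ((I j).1 : WithTop ℝ) < (I j).2) ∧
        X.Isomorphic (directSum fun j => interval F (I j)) := by
  classical
  -- The total dimension over `T` bounds the number of summands and drops with each one split off.
  induction k with
  | zero =>
    intro X hT hX hk
    have h0 : ∀ t, Subsingleton (X.obj t) := fun t => hT.subsingleton fun τ hτ _ => by
      have := hX τ
      exact Module.finrank_zero_iff.1 (Nat.le_zero.1
        ((Finset.single_le_sum (f := fun τ => Module.finrank F (X.obj τ))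
          (fun _ _ => Nat.zero_le _) hτ).trans hk))
    refine ⟨0, Fin.elim0, fun j => j.elim0, fun t => ⟨⟨⟨fun _ j => j.elim0, fun _ _ => ?_⟩,
      fun _ _ => ?_⟩, fun _ => 0, fun _ => ?_, fun _ => ?_⟩, fun _ _ _ _ => ?_⟩
    · exact funext fun j => j.elim0
    · exact funext fun j => j.elim0
    · exact (h0 t).elim _ _
    · exact funext fun j => j.elim0
    · exact funext fun j => j.elim0
  | succ k ih =>
    intro X hT hX hk
    by_cases hne : (T.filter fun τ => Nontrivial (X.obj τ)).Nonempty
    · obtain ⟨hbT, hb⟩ := Finset.mem_filter.1 (Finset.min'_mem _ hne)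
      set b := (T.filter fun τ => Nontrivial (X.obj τ)).min' hne
      obtain ⟨d, hbd, ⟨S⟩⟩ := hT.exists_splitting hbT (fun t ht => hT.subsingleton
        fun τ hτ hτt => by
          by_contra hcon
          exact absurd (Finset.min'_le _ τ (Finset.mem_filter.2
            ⟨hτ, not_subsingleton_iff_nontrivial.1 hcon⟩)) (not_le.2 (hτt.trans_lt ht))) hb
      have hlt : ∑ τ ∈ T, Module.finrank F (S.complement.obj τ) <
          ∑ τ ∈ T, Module.finrank F (X.obj τ) :=
        Finset.sum_lt_sum (fun τ _ => S.finrank_complement_le hX τ)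
          ⟨b, hbT, S.finrank_complement_lt hX ⟨le_rfl, hbd⟩⟩
      obtain ⟨n, I, hI, h⟩ := ih S.complement (S.tame_complement hT) (S.finite_complement hX)
        (by omega)
      exact ⟨n + 1, Fin.cons (b, d) I, fun j => Fin.cases hbd hI j, S.isomorphic_cons h⟩
    · refine ih X hT hX (le_trans (le_of_eq ?_) (Nat.zero_le _))
      refine Finset.sum_eq_zero fun τ hτ => ?_
      have : Subsingleton (X.obj τ) := by
        by_contra hcon
        exact hne ⟨τ, Finset.mem_filter.2 ⟨hτ, not_subsingleton_iff_nontrivial.1 hcon⟩⟩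
      exact Module.finrank_zero_of_subsingleton

theorem Tame.isDiagram_dgm {X : PersistenceModule.{u, w} F ℝ} {T : Finset ℝ} (hT : X.Tame T)
    (hX : X.PointwiseFinite) : X.IsDiagram X.dgm := by
  obtain ⟨n, I, hI, h⟩ := Tame.exists_decomposition _ X hT hX le_rfl
  refine Classical.epsilon_spec (p := X.IsDiagram) ⟨Finset.univ.val.map I, fun J hJ => ?_, n, I, rfl, h⟩
  obtain ⟨j, -, rfl⟩ := Multiset.mem_map.1 hJ
  exact hI j

/-! ## Ranks of direct sums of interval modules -/

theorem Isomorphic.rank_eq {P : Type} [Preorder P] {M : PersistenceModule.{u, w₁} F P}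
    {N : PersistenceModule.{u, w₂} F P} (h : M.Isomorphic N) {p q : P} (hpq : p ≤ q) :
    M.rank hpq = N.rank hpq := by
  obtain ⟨e, he⟩ := h
  have h1 : (LinearMap.range (M.map hpq)).map (e q).toLinearMap = LinearMap.range (N.map hpq) := by
    ext y
    simp only [Submodule.mem_map, LinearMap.mem_range]
    constructor
    · rintro ⟨_, ⟨x, rfl⟩, rfl⟩
      exact ⟨e p x, (he p q hpq x).symm⟩
    · rintro ⟨x, rfl⟩
      exact ⟨_, ⟨(e p).symm x, rfl⟩, by simpa using he p q hpq ((e p).symm x)⟩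
  unfold rank
  rw [← h1]
  exact (LinearEquiv.finrank_map_eq (e q) _).symm

open Classical in
/-- The number of intervals of a diagram that contain both `s` and `t`. -/
noncomputable def barCount (D : Multiset (ℝ × WithTop ℝ)) (s t : ℝ) : ℕ :=
  D.countP fun I => I.1 ≤ s ∧ (t : WithTop ℝ) < I.2

/-- The image is the coordinate space on the intervals containing both `s` and `t`; `Φ` is its
inclusion. -/
theorem rank_directSum_interval {n : ℕ} (I : Fin n → ℝ × WithTop ℝ) {s t : ℝ} (h : s ≤ t) :
    (directSum fun j => interval F (I j)).rank h = barCount (Finset.univ.val.map I) s t := by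
  classical
  let G : Fin n → Prop := fun j => (I j).1 ≤ s ∧ (t : WithTop ℝ) < (I j).2
  have hGs : ∀ j, G j → InInterval (I j) s := fun j hj =>
    ⟨hj.1, (WithTop.coe_le_coe.2 h).trans_lt hj.2⟩
  have hGt : ∀ j, G j → InInterval (I j) t := fun j hj => ⟨hj.1.trans h, hj.2⟩
  let Φ : ({j // G j} → F) →ₗ[F] (directSum fun j => interval F (I j)).obj t :=
    { toFun := fun f j => ⟨if hj : G j then f ⟨j, hj⟩ else 0, fun hn => by
        rw [dif_neg fun hj => hn (hGt j hj)]⟩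
      map_add' := fun f f' => funext fun j => Subtype.ext (by
        change (if hj : G j then _ else _) = (if hj : G j then _ else _) + (if hj : G j then _ else _)
        by_cases hj : G j <;> simp [hj])
      map_smul' := fun c f => funext fun j => Subtype.ext (by
        change (if hj : G j then _ else _) = c • (if hj : G j then _ else _)
        by_cases hj : G j <;> simp [hj]) }
  have hΦ : ∀ f j, @Subtype.val F (· ∈ intervalSpace F (I j) t) (Φ f j) = if hj : G j then f ⟨j, hj⟩ else 0 :=
    fun _ _ => rfl
  have hmap : ∀ (x : (directSum fun j => interval F (I j)).obj s) j,
      @Subtype.val F (· ∈ intervalSpace F (I j) t) ((directSum fun j => interval F (I j)).map h x j) =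
        if G j then @Subtype.val F (· ∈ intervalSpace F (I j) s) (x j) else 0 := by
    intro x j
    have h1 : @Subtype.val F (· ∈ intervalSpace F (I j) t) ((directSum fun j => interval F (I j)).map h x j) =
        (if InInterval (I j) t then (intervalSpace F (I j) s).subtype else 0) (x j) := rfl
    rw [h1]
    by_cases ht : InInterval (I j) t
    · by_cases hj : G j
      · simp [ht, hj]
      · have hs : ¬ InInterval (I j) s := fun hs => hj ⟨hs.1, ht.2⟩
        simp [ht, hj, (x j).2 hs]
    · have hj : ¬ G j := fun hj => ht (hGt j hj)
      rw [if_neg ht, if_neg hj]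
      rfl
  have hinj : Function.Injective Φ := by
    intro f f' hff
    funext j
    have := congrArg Subtype.val (congrFun hff j.1)
    rw [hΦ, hΦ, dif_pos j.2, dif_pos j.2] at this
    exact this
  have hrange : LinearMap.range ((directSum fun j => interval F (I j)).map h) =
      LinearMap.range Φ := by
    ext y
    constructor
    · rintro ⟨x, rfl⟩
      refine ⟨fun j => (x j.1).1, funext fun j => Subtype.ext ?_⟩
      rw [hmap, hΦ]
      by_cases hj : G j <;> simp [hj]
    · rintro ⟨f, rfl⟩
      have hx : ∀ j, (if hj : G j then f ⟨j, hj⟩ else 0) ∈ intervalSpace F (I j) s :=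
        fun j hn => dif_neg fun hj => hn (hGs j hj)
      refine ⟨fun j => ⟨_, hx j⟩, funext fun j => Subtype.ext ?_⟩
      refine (hmap (fun j => ⟨_, hx j⟩) j).trans ((hΦ f j).trans ?_).symm
      by_cases hj : G j <;> simp [hj]
  unfold rank
  rw [hrange, LinearMap.finrank_range_of_inj hinj, Module.finrank_fintype_fun_eq_card,
    Fintype.card_subtype, barCount, Multiset.countP_map]
  rfl

theorem Tame.rank_eq_barCount {X : PersistenceModule.{u, w} F ℝ} {T : Finset ℝ} (hT : X.Tame T)
    (hX : X.PointwiseFinite) {s t : ℝ} (h : s ≤ t) : X.rank h = barCount X.dgm s t := by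
  obtain ⟨-, n, I, hI, hiso⟩ := hT.isDiagram_dgm hX
  rw [hI, hiso.rank_eq h, rank_directSum_interval]

end Decomposition

end PersistenceModule


open PersistenceModule (barCount)

/-! ## Diagrams are determined by their bar counts -/

section BarCount

theorem countP_lt_countP {X : Type*} {p q : X → Prop} [DecidablePred p] [DecidablePred q]
    {D : Multiset X} (hpq : ∀ x, p x → q x) {x : X} (hx : x ∈ D) (hqx : q x) (hpx : ¬ p x) :
    D.countP p < D.countP q := by
  obtain ⟨D, rfl⟩ := Multiset.exists_cons_of_mem hx
  rw [Multiset.countP_cons_of_pos _ hqx, Multiset.countP_cons_of_neg _ hpx, Nat.lt_succ_iff,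
    Multiset.countP_eq_card_filter, Multiset.countP_eq_card_filter]
  exact Multiset.card_le_card (Multiset.monotone_filter_right _ fun x h => hpq x h)

theorem barCount_pos {D : Multiset (ℝ × WithTop ℝ)} {s t : ℝ} :
    0 < barCount D s t ↔ ∃ I ∈ D, I.1 ≤ s ∧ (t : WithTop ℝ) < I.2 := Multiset.countP_pos

theorem barCount_cons (I : ℝ × WithTop ℝ) (D : Multiset (ℝ × WithTop ℝ)) (s t : ℝ) :
    barCount (I ::ₘ D) s t = barCount D s t + barCount {I} s t := by
  classical
  unfold barCount
  rw [← Multiset.singleton_add, Multiset.countP_add, add_comm]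

theorem barCount_offDiag (D : Multiset (ℝ × WithTop ℝ)) {s t : ℝ} (h : s ≤ t) :
    barCount (offDiag D) s t = barCount D s t := by
  classical
  unfold barCount offDiag
  rw [Multiset.countP_filter]
  refine Multiset.countP_congr rfl fun I _ => propext ⟨fun hI => hI.1, fun hI => ⟨hI, ?_⟩⟩
  exact (WithTop.coe_le_coe.2 (hI.1.trans h)).trans_lt hI.2

/-- If `I` were missing from `D'`, the bars of `D'` born at `I.1` would all be dead by some `t`
before `I.2`. The count at `(I.1, t)` is positive for `D`, and a bar of `D'` realizing it would have
to be born at `I.1` and outlive `t`. -/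
theorem mem_of_extremal {D D' : Multiset (ℝ × WithTop ℝ)}
    (hcount : ∀ s t, s ≤ t → barCount D s t = barCount D' s t) {I : ℝ × WithTop ℝ}
    (hI : (I.1 : WithTop ℝ) < I.2) (hID : I ∈ D)
    (hmin : ∀ J ∈ D', I.1 < J.1 ∨ I.1 = J.1 ∧ J.2 ≤ I.2) : I ∈ D' := by
  by_contra hI'
  obtain ⟨t, hbt, htd, ht⟩ : ∃ t : ℝ, I.1 ≤ t ∧ (t : WithTop ℝ) < I.2 ∧
      ∀ J ∈ D', I.1 = J.1 → J.2 ≤ t := by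
    have hlt : ∀ J ∈ D', I.1 = J.1 → J.2 < I.2 := by
      intro J hJ hIJ
      refine lt_of_le_of_ne ?_ fun h => hI' ((Prod.ext hIJ h.symm : I = J) ▸ hJ)
      rcases hmin J hJ with h | h
      · exact absurd hIJ h.ne
      · exact h.2
    clear hmin hI' hcount
    induction D' using Multiset.induction_on with
    | empty => exact ⟨I.1, le_rfl, hI, by simp⟩
    | cons J D' ih =>
      obtain ⟨t, h1, h2, h3⟩ := ih fun J hJ => hlt J (Multiset.mem_cons_of_mem hJ)
      by_cases hIJ : I.1 = J.1
      · have hJ := hlt J (Multiset.mem_cons_self _ _) hIJ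
        lift J.2 to ℝ using (hJ.trans_le le_top).ne with d hd
        refine ⟨max t d, h1.trans (le_max_left _ _), ?_, fun J' hJ' h => ?_⟩
        · rcases max_choice t d with h | h <;> rw [h] <;> assumption
        · rcases Multiset.mem_cons.1 hJ' with rfl | hJ'
          · rw [← hd]; exact WithTop.coe_le_coe.2 (le_max_right _ _)
          · exact (h3 J' hJ' h).trans (WithTop.coe_le_coe.2 (le_max_left _ _))
      · refine ⟨t, h1, h2, fun J' hJ' h => ?_⟩
        rcases Multiset.mem_cons.1 hJ' with rfl | hJ'
        · exact absurd h hIJ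
        · exact h3 J' hJ' h
  have h1 : 0 < barCount D I.1 t := barCount_pos.2 ⟨I, hID, le_rfl, htd⟩
  rw [hcount _ _ hbt] at h1
  obtain ⟨J, hJ, hJ1, hJ2⟩ := barCount_pos.1 h1
  have hIJ : I.1 = J.1 := by
    rcases hmin J hJ with h | h
    · exact absurd hJ1 (not_le.2 h)
    · exact h.1
  exact absurd hJ2 (not_lt.2 (ht J hJ hIJ))

/-- The bar of earliest birth, and of latest death among those, must lie in both diagrams; remove it
and repeat. -/
theorem eq_of_barCount_eq (k : ℕ) : ∀ {D D' : Multiset (ℝ × WithTop ℝ)}, D.card ≤ k →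
    (∀ I ∈ D, (I.1 : WithTop ℝ) < I.2) → (∀ I ∈ D', (I.1 : WithTop ℝ) < I.2) →
    (∀ s t, s ≤ t → barCount D s t = barCount D' s t) → D = D' := by
  classical
  have hnil : ∀ {D' : Multiset (ℝ × WithTop ℝ)}, (∀ I ∈ D', (I.1 : WithTop ℝ) < I.2) →
      (∀ s t, s ≤ t → barCount 0 s t = barCount D' s t) → 0 = D' := by
    intro D' hD' h
    by_contra hne
    obtain ⟨I, hI⟩ := Multiset.exists_mem_of_ne_zero (Ne.symm hne)
    have h1 : 0 < barCount D' I.1 I.1 := barCount_pos.2 ⟨I, hI, le_rfl, hD' I hI⟩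
    rw [← h _ _ le_rfl] at h1
    obtain ⟨J, hJ, -⟩ := barCount_pos.1 h1
    simp at hJ
  induction k with
  | zero =>
    intro D D' hk _ hD' h
    obtain rfl := Multiset.card_eq_zero.1 (Nat.le_zero.1 hk)
    exact hnil hD' h
  | succ k ih =>
    intro D D' hk hD hD' h
    by_cases h0 : D = 0
    · subst h0; exact hnil hD' h
    obtain ⟨I₀, hI₀⟩ := Multiset.exists_mem_of_ne_zero h0
    obtain ⟨I, hI, hmin⟩ := Finset.exists_min_image (D + D').toFinset
      (fun I => (toLex (I.1, OrderDual.toDual I.2) : ℝ ×ₗ (WithTop ℝ)ᵒᵈ))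
      ⟨I₀, by simp [hI₀]⟩
    have hmin' : ∀ J ∈ D + D', I.1 < J.1 ∨ I.1 = J.1 ∧ J.2 ≤ I.2 := fun J hJ =>
      (Prod.Lex.toLex_le_toLex).1 (hmin J (Multiset.mem_toFinset.2 hJ))
    have hboth : I ∈ D ∧ I ∈ D' := by
      rcases Multiset.mem_add.1 (Multiset.mem_toFinset.1 hI) with hI | hI
      · exact ⟨hI, mem_of_extremal h (hD I hI) hI fun J hJ =>
          hmin' J (Multiset.mem_add.2 (Or.inr hJ))⟩
      · exact ⟨mem_of_extremal (fun s t hst => (h s t hst).symm) (hD' I hI) hI fun J hJ =>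
          hmin' J (Multiset.mem_add.2 (Or.inl hJ)), hI⟩
    obtain ⟨D, rfl⟩ := Multiset.exists_cons_of_mem hboth.1
    obtain ⟨D', rfl⟩ := Multiset.exists_cons_of_mem hboth.2
    rw [ih (by simpa using hk) (fun J hJ => hD J (Multiset.mem_cons_of_mem hJ))
      (fun J hJ => hD' J (Multiset.mem_cons_of_mem hJ)) fun s t hst => ?_]
    have := h s t hst
    rw [barCount_cons, barCount_cons I D'] at this
    omega

end BarCount

/-! ## Barcodes along sup-preserving functions -/

section Barcode

variable {F : Type u} [Field F]

/-- `D` has the bar counts prescribed by the ranks of the transition maps of `M` between the critical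
values in `S`, when the critical value `c` is placed at `g c`. -/
structure IsBarcode (M : PersistenceModule.{u, w} F Plane) (S : Set Plane) (g : Plane → ℝ)
    (D : Multiset (ℝ × WithTop ℝ)) : Prop where
  le : ∀ I ∈ D, (I.1 : WithTop ℝ) ≤ I.2
  count_zero : ∀ s t, s ≤ t → (∀ c ∈ S, s < g c) → barCount D s t = 0
  count_eq : ∀ s t, s ≤ t → ∀ (p q : Plane) (h : p ≤ q), IsGreatest {c ∈ S | g c ≤ s} p →
    IsGreatest {c ∈ S | g c ≤ t} q → barCount D s t = M.rank h

/-- The function preserves binary suprema. -/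
def SupMap (g : Plane → ℝ) : Prop := ∀ p q, g (p ⊔ q) = max (g p) (g q)

theorem SupMap.exists_isGreatest {S : Set Plane} (hS : S.Finite) (hS' : SupClosed S)
    {g : Plane → ℝ} (hg : SupMap g) {s : ℝ} (h : ∃ c ∈ S, g c ≤ s) :
    ∃ p, IsGreatest {c ∈ S | g c ≤ s} p := by
  have hfin : {c ∈ S | g c ≤ s}.Finite := hS.subset fun c hc => hc.1
  have hne : hfin.toFinset.Nonempty := hfin.toFinset_nonempty.2 h
  have hcl : SupClosed {c ∈ S | g c ≤ s} := fun p hp q hq =>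
    ⟨hS' hp.1 hq.1, (hg p q).trans_le (max_le hp.2 hq.2)⟩
  refine ⟨hfin.toFinset.sup' hne id, hcl.finsetSup'_mem hne fun c hc => hfin.mem_toFinset.1 hc,
    fun c hc => Finset.le_sup' id (hfin.mem_toFinset.2 hc)⟩

/-- The order of the values of `g` on `S` refines to the one of the values of `g₀`. -/
def OrderCompat (S : Set Plane) (g₀ g : Plane → ℝ) : Prop :=
  ∀ c ∈ S, ∀ c' ∈ S, g₀ c ≤ g₀ c' → g c ≤ g c'

/-- Sublevel sets of the coarser placement are sublevel sets of the finer one, at the largest value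
of `g₀` that they contain. -/
theorem OrderCompat.exists_level {S : Set Plane} (hS : S.Finite) {g₀ g : Plane → ℝ}
    (h : OrderCompat S g₀ g) {s : ℝ} (hs : ∃ c ∈ S, g c ≤ s) :
    ∃ c₁ ∈ S, g c₁ ≤ s ∧ ∀ c ∈ S, g c ≤ s ↔ g₀ c ≤ g₀ c₁ := by
  have hfin : {c ∈ S | g c ≤ s}.Finite := hS.subset fun c hc => hc.1
  obtain ⟨c₁, hc₁, hmax⟩ := Set.exists_max_image _ g₀ hfin hs
  exact ⟨c₁, hc₁.1, hc₁.2, fun c hc => ⟨fun h' => hmax c ⟨hc, h'⟩,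
    fun h' => (h c hc c₁ hc₁.1 h').trans hc₁.2⟩⟩

variable {M : PersistenceModule.{u, w} F Plane} {S : Set Plane} {g g₀ : Plane → ℝ}
  {D D' : Multiset (ℝ × WithTop ℝ)}

theorem IsBarcode.offDiag_eq (hS : S.Finite) (hS' : SupClosed S) (hg : SupMap g)
    (hD : IsBarcode M S g D) (hD' : IsBarcode M S g D') : offDiag D = offDiag D' := by
  classical
  refine eq_of_barCount_eq _ le_rfl (fun I hI => (Multiset.mem_filter.1 hI).2)
    (fun I hI => (Multiset.mem_filter.1 hI).2) fun s t hst => ?_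
  rw [barCount_offDiag _ hst, barCount_offDiag _ hst]
  by_cases h : ∃ c ∈ S, g c ≤ s
  · obtain ⟨p, hp⟩ := hg.exists_isGreatest hS hS' h
    obtain ⟨q, hq⟩ := hg.exists_isGreatest hS hS' (s := t)
      (h.imp fun c hc => ⟨hc.1, hc.2.trans hst⟩)
    have hpq : p ≤ q := hq.2 ⟨hp.1.1, hp.1.2.trans hst⟩
    rw [hD.count_eq s t hst p q hpq hp hq, hD'.count_eq s t hst p q hpq hp hq]
  · push Not at h
    rw [hD.count_zero s t hst h, hD'.count_zero s t hst h]

/-- Each sublevel set of `g` is one of `g₀`, so each bar count along `g` is a bar count along `g₀`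
and is given by the same rank. Values may merge, in which case bars may collapse to the diagonal. -/
theorem IsBarcode.transport (hS : S.Finite) {A : Multiset (Plane × WithTop Plane)}
    (hA : EndpointsIn A S) (h : IsBarcode M S g₀ (A.map (evalBar g₀)))
    (hc : OrderCompat S g₀ g) : IsBarcode M S g (A.map (evalBar g)) := by
  classical
  refine ⟨fun I hI => ?_, fun s t hst hs => ?_, fun s t hst p q hpq hp hq => ?_⟩
  · obtain ⟨⟨x, y⟩, hx, rfl⟩ := Multiset.mem_map.1 hI
    have h1 := h.le _ (Multiset.mem_map_of_mem _ hx)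
    have h2 := hA _ hx
    simp only [evalBar] at h1 h2 ⊢
    induction y using WithTop.recTopCoe with
    | top => exact le_top
    | coe y =>
      exact WithTop.coe_le_coe.2 (hc x h2.1 y (h2.2 y rfl) (WithTop.coe_le_coe.1 h1))
  · by_contra hne
    obtain ⟨I, hI, hI1, -⟩ := barCount_pos.1 (Nat.pos_of_ne_zero hne)
    obtain ⟨x, hx, rfl⟩ := Multiset.mem_map.1 hI
    exact absurd hI1 (not_le.2 (hs _ (hA x hx).1))
  · obtain ⟨c₁, hc₁, hc₁s, hs⟩ := hc.exists_level hS ⟨p, hp.1⟩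
    obtain ⟨c₂, hc₂, hc₂t, ht⟩ := hc.exists_level hS ⟨q, hq.1⟩
    have e1 : {c ∈ S | g c ≤ s} = {c ∈ S | g₀ c ≤ g₀ c₁} :=
      Set.ext fun c => and_congr_right (hs c)
    have e2 : {c ∈ S | g c ≤ t} = {c ∈ S | g₀ c ≤ g₀ c₂} :=
      Set.ext fun c => and_congr_right (ht c)
    rw [← h.count_eq (g₀ c₁) (g₀ c₂) ((ht c₁ hc₁).1 (hc₁s.trans hst)) p q hpq (e1 ▸ hp) (e2 ▸ hq)]
    unfold barCount
    rw [Multiset.countP_map, Multiset.countP_map]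
    congr 1
    refine Multiset.filter_congr fun x hx => ?_
    have h2 := hA x hx
    refine and_congr (hs _ h2.1) ?_
    obtain ⟨x, y⟩ := x
    simp only [evalBar] at h2 ⊢
    induction y using WithTop.recTopCoe with
    | top => simp
    | coe y =>
      simp only [WithTop.map_coe, WithTop.coe_lt_coe]
      rw [← not_le, ← not_le, ht y (h2.2 y rfl)]

/-- Bar counts are ranks that change only when a sublevel set of `g` changes, so every finite end
point is a value of `g` on `S`. -/
theorem IsBarcode.exists_lift (hS : S.Finite) (hS' : SupClosed S) (hg : SupMap g)
    (hD : IsBarcode M S g D) (hlt : ∀ I ∈ D, (I.1 : WithTop ℝ) < I.2) :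
    ∃ A : Multiset (Plane × WithTop Plane), EndpointsIn A S ∧ A.map (evalBar g) = D := by
  classical
  have key : ∀ I ∈ D, ∃ x : Plane × WithTop Plane,
      (x.1 ∈ S ∧ ∀ c : Plane, x.2 = c → c ∈ S) ∧ evalBar g x = I := by
    intro I hI
    have hne : ∃ c ∈ S, g c ≤ I.1 := by
      by_contra! h
      have h1 : 0 < barCount D I.1 I.1 := barCount_pos.2 ⟨I, hI, le_rfl, hlt I hI⟩
      rw [hD.count_zero _ _ le_rfl h] at h1
      exact lt_irrefl _ h1
    have hrefl : OrderCompat S g g := fun _ _ _ _ h => h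
    obtain ⟨p, hp⟩ := hg.exists_isGreatest hS hS' hne
    obtain ⟨c₁, hc₁, hc₁s, hs⟩ := hrefl.exists_level hS hne
    have hb : g c₁ = I.1 := by
      -- If `g c₁ < I.1`, lowering the first argument from `I.1` to `g c₁` preserves the sublevel
      -- set and hence the count, yet loses the bar `I`. The death is treated in the same way in the
      -- second argument.
      refine le_antisymm hc₁s (not_lt.1 fun hlt' => ?_)
      have e1 : {c ∈ S | g c ≤ I.1} = {c ∈ S | g c ≤ g c₁} :=
        Set.ext fun c => and_congr_right (hs c)
      have h1 := hD.count_eq I.1 I.1 le_rfl p p le_rfl hp hp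
      rw [← hD.count_eq (g c₁) I.1 hlt'.le p p le_rfl (e1 ▸ hp) hp] at h1
      exact absurd h1 (countP_lt_countP (fun J hJ => ⟨hJ.1.trans hlt'.le, hJ.2⟩) hI
        ⟨le_rfl, hlt I hI⟩ fun h => not_lt.2 h.1 hlt').ne'
    by_cases htop : I.2 = ⊤
    · exact ⟨(c₁, ⊤), ⟨hc₁, by simp⟩, Prod.ext hb htop.symm⟩
    obtain ⟨d, hd⟩ := WithTop.ne_top_iff_exists.1 htop
    have hbd : I.1 < d := by have := hlt I hI; rw [← hd] at this; exact WithTop.coe_lt_coe.1 this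
    have hne' : ∃ c ∈ S, g c ≤ d := hne.imp fun c hc => ⟨hc.1, hc.2.trans hbd.le⟩
    obtain ⟨q, hq⟩ := hg.exists_isGreatest hS hS' hne'
    obtain ⟨c₂, hc₂, hc₂s, hs₂⟩ := hrefl.exists_level hS hne'
    have hd' : g c₂ = d := by
      refine le_antisymm hc₂s (not_lt.1 fun hlt' => ?_)
      have e2 : {c ∈ S | g c ≤ d} = {c ∈ S | g c ≤ g c₂} :=
        Set.ext fun c => and_congr_right (hs₂ c)
      have hb2 : I.1 ≤ g c₂ := by rw [← hb]; exact (hs₂ c₁ hc₁).1 (hb.trans_le hbd.le)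
      have hpq : p ≤ q := hq.2 ⟨hp.1.1, hp.1.2.trans hbd.le⟩
      have h1 := hD.count_eq I.1 d hbd.le p q hpq hp hq
      rw [← hD.count_eq I.1 (g c₂) hb2 p q hpq hp (e2 ▸ hq)] at h1
      refine absurd h1 (countP_lt_countP
        (fun J hJ => ⟨hJ.1, (WithTop.coe_lt_coe.2 hlt').trans hJ.2⟩) hI ⟨le_rfl, ?_⟩
        fun h => ?_).ne
      · rw [← hd] at h; exact lt_irrefl _ h.2
      · rw [← hd]; exact WithTop.coe_lt_coe.2 hlt'
    refine ⟨(c₁, c₂), ⟨hc₁, fun c hc => WithTop.coe_injective hc ▸ hc₂⟩, Prod.ext hb ?_⟩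
    rw [← hd, ← hd']; rfl
  clear hD hlt
  induction D using Multiset.induction_on with
  | empty => exact ⟨0, by simp [EndpointsIn], rfl⟩
  | cons I D ih =>
    obtain ⟨A, hA, rfl⟩ := ih fun J hJ => key J (Multiset.mem_cons_of_mem hJ)
    obtain ⟨x, hx, rfl⟩ := key I (Multiset.mem_cons_self _ _)
    refine ⟨x ::ₘ A, fun y hy => ?_, by simp⟩
    rcases Multiset.mem_cons.1 hy with rfl | hy
    exacts [hx, hA y hy]

end Barcode

/-! ## Restrictions to lines -/

section Restrict

variable {F : Type u} [Field F]

namespace PosLine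

theorem le_pt_iff (L : PosLine) (c : Plane) (s : ℝ) : c ≤ L.pt s ↔ L.pushParam c ≤ s := by
  simp only [Pi.le_def, Fin.forall_fin_two, pushParam, max_le_iff, div_le_iff₀ (L.m_pos _), pt,
    Pi.add_apply, Pi.smul_apply, smul_eq_mul, sub_le_iff_le_add]

theorem supMap_pushParam (L : PosLine) : SupMap L.pushParam := by
  intro p q
  refine eq_of_forall_ge_iff fun s => ?_
  rw [← L.le_pt_iff, sup_le_iff, L.le_pt_iff, L.le_pt_iff, max_le_iff]

theorem weight_pos (L : PosLine) : 0 < L.weight := lt_min (L.m_pos 0) (L.m_pos 1)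

end PosLine

/-- Between two consecutive pushes the greatest critical value below the point does not change. By
(P) the rank of the map then equals the dimensions of both its source and its target. -/
theorem tame_restrict {M : PersistenceModule.{u, w} F Plane} (hM : M.PointwiseFinite)
    {C : Set Plane} (hC : PropertyP M C) (L : PosLine) :
    (M.restrict L).Tame (hC.1.supClosure.toFinset.image L.pushParam) := by
  have hfr : ∀ s : ℝ, (M.restrict L).rank (le_refl s) = Module.finrank F ((M.restrict L).obj s) := by
    intro s
    unfold PersistenceModule.rank
    rw [(M.restrict L).map_refl, LinearMap.range_id, finrank_top]
  have hzero : ∀ s : ℝ, (∀ c ∈ supClosure C, s < L.pushParam c) →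
      Subsingleton ((M.restrict L).obj s) := by
    intro s hs
    have : Module.Finite F ((M.restrict L).obj s) := hM _
    rw [← Module.finrank_zero_iff (R := F), ← hfr]
    refine (hC.2 (L.pt s) (L.pt s) _).2 (Set.eq_empty_of_forall_notMem fun c hc => ?_)
    exact absurd ((L.le_pt_iff c s).1 hc.2) (not_le.2 (hs c hc.1))
  refine ⟨fun s t h hst => ?_, fun s hs => hzero s fun c hc => hs _
    (Finset.mem_image_of_mem _ (hC.1.supClosure.mem_toFinset.2 hc))⟩
  have hst' : ∀ c ∈ supClosure C, L.pushParam c ≤ t → L.pushParam c ≤ s := fun c hc => hst _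
    (Finset.mem_image_of_mem _ (hC.1.supClosure.mem_toFinset.2 hc))
  by_cases hne : ∃ c ∈ supClosure C, L.pushParam c ≤ s
  · have : Module.Finite F ((M.restrict L).obj s) := hM _
    have : Module.Finite F ((M.restrict L).obj t) := hM _
    obtain ⟨p, hp⟩ := L.supMap_pushParam.exists_isGreatest hC.1.supClosure supClosed_supClosure hne
    have hps : IsGreatest {c ∈ supClosure C | c ≤ L.pt s} p := by
      simpa only [L.le_pt_iff] using hp
    have hpt : IsGreatest {c ∈ supClosure C | c ≤ L.pt t} p := by
      have : {c ∈ supClosure C | c ≤ L.pt t} = {c ∈ supClosure C | c ≤ L.pt s} := by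
        ext c
        simp only [L.le_pt_iff, Set.mem_ofPred_eq]
        exact and_congr_right fun hc => ⟨hst' c hc, fun h' => h'.trans h⟩
      rwa [this]
    have r1 : (M.restrict L).rank h = M.rank (le_refl p) :=
      (hC.2 (L.pt s) (L.pt t) (L.pt_mono h)).1 p p le_rfl hps hpt
    have r2 : (M.restrict L).rank (le_refl s) = M.rank (le_refl p) :=
      (hC.2 (L.pt s) (L.pt s) _).1 p p le_rfl hps hps
    have r3 : (M.restrict L).rank (le_refl t) = M.rank (le_refl p) :=
      (hC.2 (L.pt t) (L.pt t) _).1 p p le_rfl hpt hpt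
    rw [hfr] at r2 r3
    have hsurj : Function.Surjective ((M.restrict L).map h) :=
      LinearMap.range_eq_top.1 (Submodule.eq_top_of_finrank_eq (r1.trans r3.symm))
    exact ⟨(LinearMap.injective_iff_surjective_of_finrank_eq_finrank (r2.trans r3.symm)).2 hsurj,
      hsurj⟩
  · push Not at hne
    have h1 := hzero s hne
    have h2 := hzero t fun c hc => by
      by_contra hcon
      exact absurd (hst' c hc (not_lt.1 hcon)) (not_le.2 (hne c hc))
    exact ⟨fun x y _ => h1.elim x y, fun y => ⟨0, h2.elim _ y⟩⟩

theorem isBarcode_dgm {M : PersistenceModule.{u, w} F Plane} (hM : M.PointwiseFinite)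
    {C : Set Plane} (hC : PropertyP M C) (L : PosLine) :
    IsBarcode M (supClosure C) L.pushParam (M.restrict L).dgm ∧
      ∀ I ∈ (M.restrict L).dgm, (I.1 : WithTop ℝ) < I.2 := by
  have hT := tame_restrict hM hC L
  have hX : (M.restrict L).PointwiseFinite := fun s => hM _
  have hlt := (hT.isDiagram_dgm hX).1
  refine ⟨⟨fun I hI => (hlt I hI).le, fun s t hst h => ?_, fun s t hst p q hpq hp hq => ?_⟩, hlt⟩
  · rw [← hT.rank_eq_barCount hX hst]
    refine (hC.2 (L.pt s) (L.pt t) _).2 (Set.eq_empty_of_forall_notMem fun c hc => ?_)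
    exact absurd ((L.le_pt_iff c s).1 hc.2) (not_le.2 (h c hc.1))
  · rw [← hT.rank_eq_barCount hX hst]
    refine (hC.2 (L.pt s) (L.pt t) _).1 p q hpq ?_ ?_
    · simpa only [L.le_pt_iff] using hp
    · simpa only [L.le_pt_iff] using hq

/-- `κ` is the bottleneck distance of the barcodes of `M` and `N` along `g`. -/
def CostAt (M : PersistenceModule.{u, w₁} F Plane) (N : PersistenceModule.{u, w₂} F Plane)
    (SM SN : Set Plane) (g : Plane → ℝ) (κ : ℝ≥0∞) : Prop :=
  ∃ D D', IsBarcode M SM g D ∧ IsBarcode N SN g D' ∧ bottleneck D D' = κ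

theorem CostAt.unique {M : PersistenceModule.{u, w₁} F Plane}
    {N : PersistenceModule.{u, w₂} F Plane} {CM CN : Set Plane} (hCM : CM.Finite) (hCN : CN.Finite)
    {g : Plane → ℝ} (hg : SupMap g) {κ κ' : ℝ≥0∞}
    (h : CostAt M N (supClosure CM) (supClosure CN) g κ)
    (h' : CostAt M N (supClosure CM) (supClosure CN) g κ') : κ = κ' := by
  obtain ⟨D, E, hD, hE, rfl⟩ := h
  obtain ⟨D', E', hD', hE', rfl⟩ := h'
  exact bottleneck_congr_offDiag hD.le hD'.le hE.le hE'.le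
    (hD.offDiag_eq hCM.supClosure supClosed_supClosure hg hD')
    (hE.offDiag_eq hCN.supClosure supClosed_supClosure hg hE')

variable {M : PersistenceModule.{u, w₁} F Plane} {N : PersistenceModule.{u, w₂} F Plane}
  {CM CN : Set Plane}

/-- One labelling of the bars on `L` serves all the placements compatible with the order on `L`,
including limits that come from no line of positive slope. -/
theorem exists_symbolic (hM : M.PointwiseFinite) (hN : N.PointwiseFinite)
    (hCM : PropertyP M CM) (hCN : PropertyP N CN) (L : PosLine) :
    ∃ A B : Multiset (Plane × WithTop Plane), EndpointsIn A (supClosure CM) ∧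
      EndpointsIn B (supClosure CN) ∧
      bottleneck (M.restrict L).dgm (N.restrict L).dgm =
        bottleneck (A.map (evalBar L.pushParam)) (B.map (evalBar L.pushParam)) ∧
      ∀ g, OrderCompat (supClosure CM) L.pushParam g → OrderCompat (supClosure CN) L.pushParam g →
        CostAt M N (supClosure CM) (supClosure CN) g
          (bottleneck (A.map (evalBar g)) (B.map (evalBar g))) := by
  obtain ⟨hD, hD'⟩ := isBarcode_dgm hM hCM L
  obtain ⟨hE, hE'⟩ := isBarcode_dgm hN hCN L
  obtain ⟨A, hA, hAD⟩ := hD.exists_lift hCM.1.supClosure supClosed_supClosure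
    L.supMap_pushParam hD'
  obtain ⟨B, hB, hBE⟩ := hE.exists_lift hCN.1.supClosure supClosed_supClosure
    L.supMap_pushParam hE'
  refine ⟨A, B, hA, hB, by rw [hAD, hBE], fun g h h' => ⟨_, _, ?_, ?_, rfl⟩⟩
  · exact (hAD ▸ hD : IsBarcode M _ _ (A.map _)).transport hCM.1.supClosure hA h
  · exact (hBE ▸ hE : IsBarcode N _ _ (B.map _)).transport hCN.1.supClosure hB h'

theorem termValue_affine {g g₀ : Plane → ℝ} {w β : ℝ} (hw : 0 < w) (h : ∀ u, g u = w * g₀ u + β)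
    (x : WithTop Plane × WithTop Plane × ℕ) :
    termValue g x = ENNReal.ofReal w * termValue g₀ x := by
  obtain ⟨x, y, k⟩ := x
  have hw' : ENNReal.ofReal w ≠ 0 := by simpa using hw
  unfold termValue
  rw [← mul_div_assoc]
  congr 1
  simp only
  induction x using WithTop.recTopCoe <;> induction y using WithTop.recTopCoe <;>
    simp [ENNReal.mul_top hw']
  rw [← ENNReal.ofReal_mul hw.le, h, h, ← abs_of_pos hw, ← abs_mul, abs_of_pos hw]
  ring_nf

theorem bottleneck_affine (A B : Multiset (Plane × WithTop Plane)) {g g₀ : Plane → ℝ} {w β : ℝ}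
    (hw : 0 < w) (h : ∀ u, g u = w * g₀ u + β) :
    bottleneck (A.map (evalBar g)) (B.map (evalBar g)) =
      ENNReal.ofReal w * bottleneck (A.map (evalBar g₀)) (B.map (evalBar g₀)) := by
  obtain ⟨y, -, hy⟩ := exists_term_bottleneck (A := A) (B := B) (K := Set.univ)
    (fun x _ => ⟨trivial, fun _ _ => trivial⟩) (fun x _ => ⟨trivial, fun _ _ => trivial⟩) g₀
  rw [hy g₀ fun _ _ _ _ h => h, hy g fun a _ b _ hab => ?_, termValue_affine hw h]
  rw [termValue_affine hw h, termValue_affine hw h]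
  gcongr

end Restrict


/-! ## Compatible placements of the critical values -/

section Compat

/-- The placement `g` refines the order of the critical values and of the terms of `g₀`. -/
structure Compat (SM SN : Set Plane) (g₀ g : Plane → ℝ) : Prop where
  left : OrderCompat SM g₀ g
  right : OrderCompat SN g₀ g
  terms : ∀ a ∈ termsOn (SM ∪ SN), ∀ b ∈ termsOn (SM ∪ SN),
    termValue g₀ a ≤ termValue g₀ b → termValue g a ≤ termValue g b

variable {SM SN : Set Plane} {g₀ g : Plane → ℝ}

theorem OrderCompat.affine {S : Set Plane} (h : OrderCompat S g₀ g) {g' : Plane → ℝ} {w β : ℝ}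
    (hw : 0 < w) (hg' : ∀ u, g' u = w * g u + β) : OrderCompat S g₀ g' := by
  intro c hc c' hc' hcc
  rw [hg', hg']
  have := h c hc c' hc' hcc
  gcongr

theorem OrderCompat.of_tendsto {S : Set Plane} {ι : Type*} {l : Filter ι} [l.NeBot]
    {G : ι → Plane → ℝ} (h : ∀ᶠ i in l, OrderCompat S g₀ (G i))
    (hG : ∀ u ∈ S, Tendsto (fun i => G i u) l (𝓝 (g u))) : OrderCompat S g₀ g :=
  fun c hc c' hc' hcc => le_of_tendsto_of_tendsto (hG c hc) (hG c' hc')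
    (h.mono fun _ hi => hi c hc c' hc' hcc)

theorem Compat.affine (h : Compat SM SN g₀ g) {g' : Plane → ℝ} {w β : ℝ} (hw : 0 < w)
    (hg' : ∀ u, g' u = w * g u + β) : Compat SM SN g₀ g' := by
  refine ⟨h.left.affine hw hg', h.right.affine hw hg', fun a ha b hb hab => ?_⟩
  rw [termValue_affine hw hg', termValue_affine hw hg']
  have := h.terms a ha b hb hab
  gcongr

theorem Compat.of_tendsto {ι : Type*} {l : Filter ι} [l.NeBot] {G : ι → Plane → ℝ}
    (h : ∀ᶠ i in l, Compat SM SN g₀ (G i))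
    (hG : ∀ u ∈ SM ∪ SN, Tendsto (fun i => G i u) l (𝓝 (g u))) : Compat SM SN g₀ g where
  left := .of_tendsto (h.mono fun _ hi => hi.left) fun u hu => hG u (Or.inl hu)
  right := .of_tendsto (h.mono fun _ hi => hi.right) fun u hu => hG u (Or.inr hu)
  terms a ha b hb hab := le_of_tendsto_of_tendsto (tendsto_termValue hG ha)
    (tendsto_termValue hG hb) (h.mono fun _ hi => hi.terms a ha b hb hab)

theorem termValue_coe {α : Type} (g : α → ℝ) (u v : α) {k : ℕ} (hk : k = 1 ∨ k = 2) :
    termValue g ((u : WithTop α), (v : WithTop α), k) = ENNReal.ofReal (|g u - g v| / k) := by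
  have hk0 : (0 : ℝ) < k := by rcases hk with rfl | rfl <;> norm_num
  rw [ENNReal.ofReal_div_of_pos hk0, ENNReal.ofReal_natCast]
  rfl

theorem termValue_top_top {α : Type} (g : α → ℝ) (k : ℕ) :
    termValue g ((⊤ : WithTop α), (⊤ : WithTop α), k) = 0 := by
  simp [termValue]

theorem termValue_coe_top {α : Type} (g : α → ℝ) (u : α) (k : ℕ) :
    termValue g ((u : WithTop α), (⊤ : WithTop α), k) = ∞ := by
  simp [termValue, ENNReal.top_div]

theorem termValue_top_coe {α : Type} (g : α → ℝ) (u : α) (k : ℕ) :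
    termValue g ((⊤ : WithTop α), (u : WithTop α), k) = ∞ := by
  simp [termValue, ENNReal.top_div]

theorem terms_of_real {K : Set Plane}
    (h : ∀ u ∈ K, ∀ v ∈ K, ∀ x ∈ K, ∀ y ∈ K, ∀ k k' : ℕ, (k = 1 ∨ k = 2) → (k' = 1 ∨ k' = 2) →
      |g₀ u - g₀ v| / k ≤ |g₀ x - g₀ y| / k' → |g u - g v| / k ≤ |g x - g y| / k') :
    ∀ a ∈ termsOn K, ∀ b ∈ termsOn K, termValue g₀ a ≤ termValue g₀ b →
      termValue g a ≤ termValue g b := by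
  rintro ⟨u, v, k⟩ ⟨hu, hv, hk⟩ ⟨x, y, k'⟩ ⟨hx, hy, hk'⟩ hab
  simp only at hu hv hk hx hy hk'
  induction u using WithTop.recTopCoe <;> induction v using WithTop.recTopCoe <;>
    induction x using WithTop.recTopCoe <;> induction y using WithTop.recTopCoe <;>
    simp only [termValue_top_top, termValue_coe_top, termValue_top_coe, le_refl, le_top, zero_le,
      top_le_iff, ENNReal.zero_ne_top, termValue_coe _ _ _ hk, termValue_coe _ _ _ hk',
      ENNReal.ofReal_ne_top] at hab ⊢
  -- The right-hand term is `(⊤, ⊤)`, with value zero; the real term `|u - u| / k'` replaces it.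
  · rename_i u v
    have h0 : |g₀ u - g₀ v| / k ≤ 0 := by simpa using hab
    have h1 := h u (hu u rfl) v (hv v rfl) u (hu u rfl) u (hu u rfl) k k' hk hk' (by simpa using h0)
    simpa using h1
  · rename_i u v x y
    refine ENNReal.ofReal_le_ofReal (h u (hu u rfl) v (hv v rfl) x (hx x rfl) y (hy y rfl) k k' hk
      hk' ?_)
    exact (ENNReal.ofReal_le_ofReal_iff (by positivity)).1 hab

theorem nonpos_of_sign_eq {x y : ℝ} (h : SignType.sign x = SignType.sign y) (hx : x ≤ 0) :
    y ≤ 0 := by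
  by_contra hy
  rw [sign_pos (not_le.1 hy), sign_eq_one_iff] at h
  exact absurd h (not_lt.2 hx)

/-- Property (Q) compares terms directly. It also controls the order of the pushes: `c` is pushed no
further than `c'` exactly when the term of `c ⊔ c'` and `c'` vanishes. This needs the join within
the closure of one module, as the union need not be closed under joins. -/
theorem compat_of_equivalent {CM CN : Set Plane} {Ω : Set ProjPlane}
    (hΩ : PropertyQ (supClosure CM ∪ supClosure CN) Ω) {L₀ L : PosLine}
    (h : PosLine.Equivalent (proper '' (supClosure CM ∪ supClosure CN) ∪ Ω) L₀ L) :
    Compat (supClosure CM) (supClosure CN) L₀.pushParam L.pushParam := by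
  have hreal : ∀ u ∈ supClosure CM ∪ supClosure CN, ∀ v ∈ supClosure CM ∪ supClosure CN,
      ∀ x ∈ supClosure CM ∪ supClosure CN, ∀ y ∈ supClosure CM ∪ supClosure CN,
      ∀ k k' : ℕ, (k = 1 ∨ k = 2) → (k' = 1 ∨ k' = 2) →
      |L₀.pushParam u - L₀.pushParam v| / k ≤ |L₀.pushParam x - L₀.pushParam y| / k' →
        |L.pushParam u - L.pushParam v| / k ≤ |L.pushParam x - L.pushParam y| / k' := by
    intro u hu v hv x hx y hy k k' hk hk' hle
    have := nonpos_of_sign_eq (hΩ.2 u hu v hv x hx y hy k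
      (by rcases hk with rfl | rfl <;> simp) k' (by rcases hk' with rfl | rfl <;> simp) L₀ L h)
      (sub_nonpos.2 hle)
    exact sub_nonpos.1 this
  have hord : ∀ C, supClosure C ⊆ supClosure CM ∪ supClosure CN →
      OrderCompat (supClosure C) L₀.pushParam L.pushParam := by
    intro C hC c hc c' hc' hcc
    have h1 := hreal _ (hC (supClosed_supClosure hc hc')) _ (hC hc') _ (hC hc) _ (hC hc) 1 1
      (Or.inl rfl) (Or.inl rfl) (by simp [L₀.supMap_pushParam c c', hcc])
    simp only [sub_self, abs_zero, Nat.cast_one, div_one, abs_nonpos_iff, sub_eq_zero,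
      L.supMap_pushParam c c'] at h1
    exact max_eq_right_iff.1 h1
  exact ⟨hord CM Set.subset_union_left, hord CN Set.subset_union_right, terms_of_real hreal⟩

end Compat

/-! ## The weighted distance as a cost -/

section Cost

variable {F : Type u} [Field F] {M : PersistenceModule.{u, w₁} F Plane}
  {N : PersistenceModule.{u, w₂} F Plane} {CM CN : Set Plane}

theorem OrderCompat.refl (S : Set Plane) (g : Plane → ℝ) : OrderCompat S g g :=
  fun _ _ _ _ h => h

theorem costAt_weightedDist (hM : M.PointwiseFinite) (hN : N.PointwiseFinite)
    (hCM : PropertyP M CM) (hCN : PropertyP N CN) (L : PosLine) {g : Plane → ℝ} {β : ℝ}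
    (hg : ∀ u, g u = L.weight * L.pushParam u + β) :
    CostAt M N (supClosure CM) (supClosure CN) g (weightedDist M N L) := by
  obtain ⟨A, B, -, -, h, hcost⟩ := exists_symbolic hM hN hCM hCN L
  have := hcost g ((OrderCompat.refl _ _).affine L.weight_pos hg)
    ((OrderCompat.refl _ _).affine L.weight_pos hg)
  rwa [bottleneck_affine A B L.weight_pos hg, ← h] at this

theorem exists_term_costAt (hM : M.PointwiseFinite) (hN : N.PointwiseFinite)
    (hCM : PropertyP M CM) (hCN : PropertyP N CN) (L₀ : PosLine) :
    ∃ y ∈ termsOn (supClosure CM ∪ supClosure CN), ∀ g,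
      Compat (supClosure CM) (supClosure CN) L₀.pushParam g →
        CostAt M N (supClosure CM) (supClosure CN) g (termValue g y) := by
  obtain ⟨A, B, hA, hB, -, hcost⟩ := exists_symbolic hM hN hCM hCN L₀
  obtain ⟨y, hy, h⟩ := exists_term_bottleneck (hA.mono Set.subset_union_left)
    (hB.mono Set.subset_union_right) L₀.pushParam
  refine ⟨y, hy, fun g hg => ?_⟩
  rw [← h g hg.terms]
  exact hcost g hg.left hg.right

theorem SupMap.affine {g g' : Plane → ℝ} (h : SupMap g) {w β : ℝ} (hw : 0 < w)
    (hg : ∀ u, g' u = w * g u + β) : SupMap g' := by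
  intro p q
  have hm : Monotone fun x : ℝ => w * x + β := fun x y hxy => by
    change w * x + β ≤ w * y + β
    gcongr
  rw [hg, hg, hg, h p q]
  exact hm.map_max

/-- The weighted distance converges along every filter along which the weighted placements of the
critical values converge. -/
theorem tendsto_weightedDist (hM : M.PointwiseFinite) (hN : N.PointwiseFinite)
    (hCM : PropertyP M CM) (hCN : PropertyP N CN) {l : Filter PosLine} {G : PosLine → Plane → ℝ}
    {g : Plane → ℝ} (hg : SupMap g)
    (hG : ∀ᶠ L in l, ∃ β, ∀ u, G L u = L.weight * L.pushParam u + β)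
    (hlim : ∀ u, Tendsto (fun L => G L u) l (𝓝 (g u))) {κ : ℝ≥0∞}
    (hκ : CostAt M N (supClosure CM) (supClosure CN) g κ) :
    Tendsto (weightedDist M N) l (𝓝 κ) := by
  -- The order of the pushes may keep changing along `l`. Along an ultrafilter it is eventually
  -- constant, because there are finitely many pairs, and a single labelling of the bars suffices.
  rw [tendsto_iff_ultrafilter]
  intro U hU
  set K := supClosure CM ∪ supClosure CN with hK
  have hKfin : K.Finite := hCM.1.supClosure.union hCN.1.supClosure
  let Q : Plane × Plane → Prop := fun x => ∀ᶠ L in (U : Filter PosLine),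
    L.pushParam x.1 ≤ L.pushParam x.2
  have hev : ∀ᶠ L in (U : Filter PosLine), ∀ x ∈ K ×ˢ K,
      (L.pushParam x.1 ≤ L.pushParam x.2 ↔ Q x) := by
    rw [eventually_all_finite (hKfin.prod hKfin)]
    intro x _
    by_cases hx : Q x
    · exact hx.mono fun L hL => ⟨fun _ => hx, fun _ => hL⟩
    · exact (Ultrafilter.eventually_not.2 hx).mono fun L hL =>
        ⟨fun h => absurd h hL, fun h => absurd h hx⟩
  obtain ⟨L₁, hL₁⟩ := hev.exists
  have hord : ∀ᶠ L in (U : Filter PosLine), OrderCompat K L₁.pushParam (G L) := by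
    filter_upwards [hev, hU hG] with L hL ⟨β, hβ⟩
    refine OrderCompat.affine (g := L.pushParam) (fun c hc c' hc' h => ?_) L.weight_pos hβ
    exact (hL (c, c') ⟨hc, hc'⟩).2 ((hL₁ (c, c') ⟨hc, hc'⟩).1 h)
  have hordg : OrderCompat K L₁.pushParam g :=
    OrderCompat.of_tendsto hord fun u _ => (hlim u).mono_left hU
  have hsub : ∀ {S : Set Plane} {g : Plane → ℝ}, S ⊆ K → OrderCompat K L₁.pushParam g →
      OrderCompat S L₁.pushParam g := fun hS h c hc c' hc' => h c (hS hc) c' (hS hc')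
  obtain ⟨A, B, hA, hB, -, hcost⟩ := exists_symbolic hM hN hCM hCN L₁
  -- The limit placement respects the order of `L₁` weakly, so the same labelled bars compute `κ`.
  -- By uniqueness the value does not depend on the ultrafilter.
  rw [hκ.unique hCM.1 hCN.1 hg (hcost g (hsub Set.subset_union_left hordg)
    (hsub Set.subset_union_right hordg))]
  refine (tendsto_bottleneck_map (hA.mono Set.subset_union_left) (hB.mono Set.subset_union_right)
    (g := G) fun c _ => (hlim c).mono_left hU).congr' ?_
  filter_upwards [hord, hU hG] with L hL ⟨β, hβ⟩
  exact (hcost (G L) (hsub Set.subset_union_left hL) (hsub Set.subset_union_right hL)).unique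
    hCM.1 hCN.1 (L.supMap_pushParam.affine L.weight_pos hβ)
    (costAt_weightedDist hM hN hCM hCN L hβ)

end Cost


/-! ## Points of the projective plane on a line -/

section Projective

theorem proper_injective : Function.Injective proper := by
  intro p q h
  obtain ⟨a, ha⟩ := (Projectivization.mk_eq_mk_iff' ℝ _ _ _ _).1 h
  have h0 : a = 1 := by simpa using congrFun ha 0
  subst h0
  ext k
  fin_cases k
  · simpa using (congrFun ha 1).symm
  · simpa using (congrFun ha 2).symm

theorem proper_ne_atInfinity (u v : Plane) (hv : v ≠ 0) : proper u ≠ atInfinity v hv := by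
  intro h
  obtain ⟨a, ha⟩ := (Projectivization.mk_eq_mk_iff' ℝ _ _ _ _).1 h
  simpa using congrFun ha 0

theorem atInfinity_eq_iff {v w : Plane} (hv : v ≠ 0) (hw : w ≠ 0) :
    atInfinity v hv = atInfinity w hw ↔ ∃ a : ℝ, a • w = v := by
  unfold atInfinity
  rw [Projectivization.mk_eq_mk_iff']
  refine exists_congr fun a => ⟨fun ha => ?_, fun ha => ?_⟩
  · ext k
    fin_cases k
    · simpa using congrFun ha 1
    · simpa using congrFun ha 2
  · subst ha
    ext k
    fin_cases k <;> simp

theorem fin_two_cases {i j : Fin 2} (hij : i ≠ j) (k : Fin 2) : k = i ∨ k = j := by omega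

theorem forall_fin_two_of_ne {i j : Fin 2} (hij : i ≠ j) {P : Fin 2 → Prop} :
    (∀ k, P k) ↔ P i ∧ P j := by
  refine ⟨fun h => ⟨h i, h j⟩, fun h k => ?_⟩
  rcases fin_two_cases hij k with rfl | rfl
  exacts [h.1, h.2]

/-! ### Reciprocal position as an incidence condition on steep lines. -/

namespace PosLine

theorem inter_projFace_proper_nonempty (L : PosLine) (A : Set (Fin 2)) (u : Plane) :
    (L.projCarrier ∩ projFace A (proper u)).Nonempty ↔ ∃ s, L.pt s ∈ openFace A u := by
  constructor
  · rintro ⟨q, hq, ⟨u', x, hu, rfl, hx⟩ | ⟨v, x, hv, -, -, hu, -⟩⟩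
    · obtain rfl := proper_injective hu
      rcases hq with ⟨y, ⟨s, rfl⟩, hy⟩ | hq
      · exact ⟨s, proper_injective hy ▸ hx⟩
      · exact absurd hq (proper_ne_atInfinity _ _ _)
    · exact absurd hu (proper_ne_atInfinity _ _ _)
  · rintro ⟨s, hs⟩
    exact ⟨proper (L.pt s), Or.inl ⟨_, ⟨s, rfl⟩, rfl⟩, Or.inl ⟨u, _, rfl, rfl, hs⟩⟩

theorem inter_projFace_atInfinity_nonempty (L : PosLine) (A : Set (Fin 2)) {v : Plane}
    (hv : v ≠ 0) (hpos : ∀ k, 0 < v k) :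
    (L.projCarrier ∩ projFace A (atInfinity v hv)).Nonempty ↔
      ∃ t : ℝ, t • L.m ∈ openFace A v := by
  constructor
  · rintro ⟨q, hq, ⟨u', x, hu, -, -⟩ | ⟨v', x, hv', hx0, hpos', hvv, rfl, hx⟩⟩
    · exact absurd hu.symm (proper_ne_atInfinity _ _ _)
    · rcases hq with ⟨y, -, hy⟩ | hq
      · exact absurd hy (proper_ne_atInfinity _ _ _)
      · obtain ⟨a, rfl⟩ := (atInfinity_eq_iff _ _).1 hq
        obtain ⟨b, rfl⟩ := (atInfinity_eq_iff _ _).1 hvv.symm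
        have hb : 0 < b := by
          have := hpos' 0
          simp only [Pi.smul_apply, smul_eq_mul] at this
          exact (pos_iff_pos_of_mul_pos this).2 (hpos 0)
        refine ⟨a / b, fun k => ?_⟩
        have := hx k
        simp only [Pi.smul_apply, smul_eq_mul] at this ⊢
        refine ⟨fun hk => ?_, fun hk => ?_⟩
        · rw [div_mul_eq_mul_div, this.1 hk]
          field_simp
        · rw [div_mul_eq_mul_div, lt_div_iff₀ hb, mul_comm]
          exact this.2 hk
  · rintro ⟨t, ht⟩
    have htpos : t • L.m ≠ 0 := by
      intro h0
      have h1 := ht 0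
      have h2 := hpos 0
      rw [h0] at h1
      simp only [Pi.zero_apply] at h1
      by_cases h : (0 : Fin 2) ∈ A
      · exact absurd (h1.1 h) h2.ne
      · exact absurd (h1.2 h) (not_lt.2 h2.le)
    refine ⟨atInfinity L.m L.m_ne_zero, Or.inr rfl, Or.inr
      ⟨v, t • L.m, hv, htpos, hpos, rfl, ?_, ht⟩⟩
    refine (atInfinity_eq_iff _ _).2 ⟨t⁻¹, ?_⟩
    have : t ≠ 0 := fun h => htpos (by simp [h])
    rw [smul_smul, inv_mul_cancel₀ this, one_smul]

theorem inter_projFace_eq_empty (L : PosLine) (A : Set (Fin 2)) {p : ProjPlane}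
    (hp : ¬ ∃ u, p = proper u) (hp' : ¬ ∃ (v : Plane) (hv : v ≠ 0), (∀ k, 0 < v k) ∧
      p = atInfinity v hv) : ¬ (L.projCarrier ∩ projFace A p).Nonempty := by
  rintro ⟨q, -, ⟨u', x, hu, -, -⟩ | ⟨v', x, hv', hx0, hpos', hvv, -, -⟩⟩
  · exact hp ⟨_, hu⟩
  · exact hp' ⟨_, hv', hpos', hvv⟩

variable {i j : Fin 2}

/-- The position of a line `x i = μ * x j + c` is measured by `c`. -/
def offset (L : PosLine) (i j : Fin 2) : ℝ := L.b i - L.m i * L.b j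

theorem pt_apply_eq (L : PosLine) (hm : L.m j = 1) (s : ℝ) :
    L.pt s i = L.m i * L.pt s j + L.offset i j := by
  simp only [pt, offset, Pi.add_apply, Pi.smul_apply, smul_eq_mul, hm]
  ring

theorem exists_pt_eq (L : PosLine) (hij : i ≠ j) (hm : L.m j = 1) {x : Plane}
    (hx : x i = L.m i * x j + L.offset i j) : ∃ s, L.pt s = x := by
  refine ⟨x j - L.b j, funext ((forall_fin_two_of_ne hij).2 ?_)⟩
  have hj : L.pt (x j - L.b j) j = x j := by simp [pt, hm]
  exact ⟨by rw [L.pt_apply_eq hm, hj, hx], hj⟩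

/-- When `u` is strictly to the right, the line enters the cone of `u` through the open ray `x i = u
i`, `u j < x j`, and misses both the apex and the other ray. -/
theorem exists_pt_mem_openFace_of_right (L : PosLine) (hij : i ≠ j) (hm : L.m j = 1)
    {u : Plane} (hu : L.m i * u j + L.offset i j < u i) {A : Set (Fin 2)} (hA : A.Nonempty) :
    (∃ s, L.pt s ∈ openFace A u) ↔ i ∈ A ∧ j ∉ A := by
  have hmi := L.m_pos i
  constructor
  · rintro ⟨s, hs⟩
    have hj : j ∉ A := by
      intro hj
      have h1 := (hs j).1 hj
      have h2 : u i ≤ L.pt s i := by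
        by_cases h : i ∈ A
        exacts [((hs i).1 h).ge, ((hs i).2 h).le]
      rw [L.pt_apply_eq (j := j) hm, h1] at h2
      linarith
    obtain ⟨k, hk⟩ := hA
    rcases fin_two_cases hij k with rfl | rfl
    exacts [⟨hk, hj⟩, absurd hk hj]
  · rintro ⟨hi, hj⟩
    obtain ⟨s, hs⟩ := L.exists_pt_eq hij hm (x := Function.update u j ((u i - L.offset i j) / L.m i))
      (by rw [Function.update_of_ne hij, Function.update_self]; field_simp; ring)
    refine ⟨s, (forall_fin_two_of_ne hij).2 ?_⟩
    rw [hs, Function.update_of_ne hij, Function.update_self]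
    refine ⟨⟨fun _ => rfl, fun h => absurd hi h⟩, fun h => absurd h hj, fun _ => ?_⟩
    rw [lt_div_iff₀ hmi]; linarith

theorem exists_pt_mem_openFace_of_left (L : PosLine) (hij : i ≠ j) (hm : L.m j = 1)
    {u : Plane} (hu : u i < L.m i * u j + L.offset i j) {A : Set (Fin 2)} (hA : A.Nonempty) :
    (∃ s, L.pt s ∈ openFace A u) ↔ j ∈ A ∧ i ∉ A := by
  have hmi := L.m_pos i
  constructor
  · rintro ⟨s, hs⟩
    have hi : i ∉ A := by
      intro hi
      have h1 := (hs i).1 hi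
      have h2 : u j ≤ L.pt s j := by
        by_cases h : j ∈ A
        exacts [((hs j).1 h).ge, ((hs j).2 h).le]
      rw [L.pt_apply_eq (j := j) hm] at h1
      nlinarith
    obtain ⟨k, hk⟩ := hA
    rcases fin_two_cases hij k with rfl | rfl
    exacts [absurd hk hi, ⟨hk, hi⟩]
  · rintro ⟨hj, hi⟩
    obtain ⟨s, hs⟩ := L.exists_pt_eq hij hm (x := Function.update u i (L.m i * u j + L.offset i j))
      (by rw [Function.update_of_ne hij.symm, Function.update_self])
    refine ⟨s, (forall_fin_two_of_ne hij).2 ?_⟩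
    rw [hs, Function.update_of_ne hij.symm, Function.update_self]
    exact ⟨⟨fun h => absurd h hi, fun _ => hu⟩, fun _ => rfl, fun h => absurd hj h⟩

theorem exists_smul_mem_openFace_of_steeper (L : PosLine) (hij : i ≠ j) (hm : L.m j = 1)
    {v : Plane} (hv : L.m i * v j < v i) {A : Set (Fin 2)} (hA : A.Nonempty) :
    (∃ t : ℝ, t • L.m ∈ openFace A v) ↔ i ∈ A ∧ j ∉ A := by
  have hmi := L.m_pos i
  constructor
  · rintro ⟨s, hs⟩
    have hs' : ∀ k, (s • L.m) k = s * L.m k := fun _ => rfl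
    have hj : j ∉ A := by
      intro hj
      have h1 := (hs j).1 hj
      have h2 : v i ≤ (s • L.m) i := by
        by_cases h : i ∈ A
        exacts [((hs i).1 h).ge, ((hs i).2 h).le]
      rw [hs', hm, mul_one] at h1
      rw [hs', h1, mul_comm] at h2
      linarith
    obtain ⟨k, hk⟩ := hA
    rcases fin_two_cases hij k with rfl | rfl
    exacts [⟨hk, hj⟩, absurd hk hj]
  · rintro ⟨hi, hj⟩
    refine ⟨v i / L.m i, (forall_fin_two_of_ne hij).2 ⟨⟨fun _ => ?_, fun h => absurd hi h⟩,
      fun h => absurd h hj, fun _ => ?_⟩⟩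
    · simp only [Pi.smul_apply, smul_eq_mul]; field_simp
    · simp only [Pi.smul_apply, smul_eq_mul, hm, mul_one]
      rw [lt_div_iff₀ hmi, mul_comm]; exact hv

/-- Steep lines that separate the proper points of `U` in the same way are equivalent. -/
theorem equivalent_of_separate {U : Set ProjPlane} {L L' : PosLine} (hij : i ≠ j)
    (hm : L.m j = 1) (hm' : L'.m j = 1)
    (hU : ∀ u, proper u ∈ U →
      (u i < L.m i * u j + L.offset i j ∧ u i < L'.m i * u j + L'.offset i j) ∨
      (L.m i * u j + L.offset i j < u i ∧ L'.m i * u j + L'.offset i j < u i))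
    (hU' : ∀ (v : Plane) (hv : v ≠ 0), (∀ k, 0 < v k) → atInfinity v hv ∈ U →
      L.m i * v j < v i ∧ L'.m i * v j < v i) :
    Equivalent U L L' := by
  intro p hp
  unfold position
  congr 1
  ext A
  refine and_congr_right fun hA => ?_
  by_cases h1 : ∃ u, p = proper u
  · obtain ⟨u, rfl⟩ := h1
    rw [inter_projFace_proper_nonempty, inter_projFace_proper_nonempty]
    rcases hU u hp with ⟨h, h'⟩ | ⟨h, h'⟩
    · rw [L.exists_pt_mem_openFace_of_left hij hm h hA, L'.exists_pt_mem_openFace_of_left hij hm' h' hA]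
    · rw [L.exists_pt_mem_openFace_of_right hij hm h hA,
        L'.exists_pt_mem_openFace_of_right hij hm' h' hA]
  · by_cases h2 : ∃ (v : Plane) (hv : v ≠ 0), (∀ k, 0 < v k) ∧ p = atInfinity v hv
    · obtain ⟨v, hv, hpos, rfl⟩ := h2
      obtain ⟨h, h'⟩ := hU' v hv hpos hp
      rw [L.inter_projFace_atInfinity_nonempty A hv hpos,
        L'.inter_projFace_atInfinity_nonempty A hv hpos,
        L.exists_smul_mem_openFace_of_steeper hij hm h hA,
        L'.exists_smul_mem_openFace_of_steeper hij hm' h' hA]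
    · exact iff_of_false (L.inter_projFace_eq_empty A h1 h2) (L'.inter_projFace_eq_empty A h1 h2)

end PosLine

/-- The direction whose coordinates are `μ` at `i`, and one otherwise. -/
def direction (i : Fin 2) (μ : ℝ) : Plane := fun k => if k = i then μ else 1

theorem direction_ne_zero {i j : Fin 2} (hij : i ≠ j) (μ : ℝ) : direction i μ ≠ 0 := fun h => by
  simpa [direction, hij.symm] using congrFun h j

/-- The line `x i = μ * x j + c`. -/
noncomputable def steepLine {i j : Fin 2} (hij : i ≠ j) (μ c : ℝ) (hμ : 0 < μ) (hμ1 : μ ≤ 1) :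
    PosLine where
  m := direction i μ
  b := fun k => if k = i then c / (1 + μ) else -(c / (1 + μ))
  m_pos k := by unfold direction; split_ifs <;> simp [hμ]
  m_max := by
    rcases fin_two_cases hij 0 with h | h <;> rcases fin_two_cases hij 1 with h' | h' <;>
      simp [direction, h, h', hij.symm, hμ1]; omega
  b_sum := by
    rcases fin_two_cases hij 0 with h | h <;> rcases fin_two_cases hij 1 with h' | h' <;>
      simp [h, h', hij.symm] <;> omega

section SteepLine

variable {i j : Fin 2} (hij : i ≠ j) {μ c : ℝ} (hμ : 0 < μ) (hμ1 : μ ≤ 1)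

theorem steepLine_m_left : (steepLine hij μ c hμ hμ1).m i = μ := by simp [steepLine, direction]

theorem steepLine_m_right : (steepLine hij μ c hμ hμ1).m j = 1 := by
  simp [steepLine, direction, hij.symm]

theorem steepLine_offset : (steepLine hij μ c hμ hμ1).offset i j = c := by
  simp only [PosLine.offset, steepLine_m_left]
  simp only [steepLine, if_true, hij.symm, if_false]
  field_simp
  ring

end SteepLine

/-- The weighted parameter, up to a constant, of the push onto the line `x i = μ * x j + c`. -/
def lineFn (i j : Fin 2) (μ c : ℝ) (u : Plane) : ℝ := max (u i) (μ * u j + c)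

/-- Since `m j = 1` is the larger coordinate, the weight `m i` cancels the only denominator of the
push parameter. The left-hand side extends continuously to `m i = 0`. -/
theorem PosLine.lineFn_eq (L : PosLine) {i j : Fin 2} (hij : i ≠ j) (hm : L.m j = 1) (u : Plane) :
    lineFn i j (L.m i) (L.offset i j) u = L.weight * L.pushParam u + L.b i := by
  have hmi := L.m_pos i
  have hle : L.m i ≤ 1 := by
    rcases fin_two_cases hij 0 with h | h <;> rcases fin_two_cases hij 1 with h' | h' <;>
      have := L.m_max <;> rw [h, h'] at this
    · omega
    · exact (le_max_left _ _).trans this.le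
    · exact (le_max_right _ _).trans this.le
    · omega
  have hw : L.weight = L.m i := by
    unfold PosLine.weight
    rcases fin_two_cases hij 0 with h | h <;> rcases fin_two_cases hij 1 with h' | h'
    · omega
    · rw [h, h', hm, min_eq_left hle]
    · rw [h, h', hm, min_eq_right hle]
    · omega
  have hp : L.pushParam u = max ((u i - L.b i) / L.m i) (u j - L.b j) := by
    unfold PosLine.pushParam
    rcases fin_two_cases hij 0 with h | h <;> rcases fin_two_cases hij 1 with h' | h'
    · omega
    · rw [h, h', hm, div_one]
    · rw [h, h', hm, div_one, max_comm]
    · omega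
  rw [hw, hp, mul_max_of_nonneg _ _ hmi.le, ← max_add_add_right, lineFn, PosLine.offset]
  congr 1
  · field_simp; ring
  · ring

theorem supMap_lineFn (i j : Fin 2) {μ : ℝ} (hμ : 0 ≤ μ) (c : ℝ) : SupMap (lineFn i j μ c) := by
  intro p q
  have h : μ * max (p j) (q j) + c = max (μ * p j + c) (μ * q j + c) := by
    rw [mul_max_of_nonneg _ _ hμ, max_add_add_right]
  change max (max (p i) (q i)) (μ * max (p j) (q j) + c) = _
  rw [h]
  exact max_max_max_comm _ _ _ _

end Projective


/-! ## Lines near a vertical or horizontal line -/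

section Cell

/-- The points `w` of `W` with `w i < a` lie weakly to the left of the line `x i = μ * x j + c`, and
the other ones weakly to the right. -/
def Separates (W : Set Plane) (i j : Fin 2) (a μ c : ℝ) : Prop :=
  ∀ w ∈ W, (w i < a → w i ≤ μ * w j + c) ∧ (a ≤ w i → μ * w j + c ≤ w i)

/-- The points `w` of `W` with `w i < a` lie strictly to the left of the line `x i = μ * x j + c`,
and the other ones strictly to the right. -/
def StrictlySeparates (W : Set Plane) (i j : Fin 2) (a μ c : ℝ) : Prop :=
  ∀ w ∈ W, (w i < a → w i < μ * w j + c) ∧ (a ≤ w i → μ * w j + c < w i)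

variable {W : Set Plane} {i j : Fin 2} {a : ℝ}

/-- The value `μ₁` is the least of three kinds of obstruction: `1`, beyond which the normalization
`m j = 1` fails; the slopes in `V`; and the slopes of lines joining a left point to a right point
with larger coordinate `j`. For other pairs the separation inequality is automatic. -/
theorem exists_critical_slope (hW : W.Finite) {V : Set ℝ} (hV : V.Finite)
    (hpos : ∀ ν ∈ V, 0 < ν) :
    ∃ μ₁ : ℝ, 0 < μ₁ ∧ μ₁ ≤ 1 ∧ (∀ ν ∈ V, μ₁ ≤ ν) ∧
      (∀ w ∈ W, ∀ w' ∈ W, w i < a → a ≤ w' i → μ₁ * (w' j - w j) ≤ w' i - w i) ∧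
      (μ₁ = 1 ∨ μ₁ ∈ V ∨ ∃ w ∈ W, ∃ w' ∈ W, w i < a ∧ a ≤ w' i ∧
        μ₁ * (w' j - w j) = w' i - w i) := by
  let P : Set (Plane × Plane) := {x ∈ W ×ˢ W | x.1 i < a ∧ a ≤ x.2 i ∧ x.1 j < x.2 j}
  let f : Plane × Plane → ℝ := fun x => (x.2 i - x.1 i) / (x.2 j - x.1 j)
  have hP : P.Finite := (hW.prod hW).subset fun x hx => hx.1
  obtain ⟨μ₁, hμ₁, hmin⟩ := Set.exists_min_image ({1} ∪ (V ∪ f '' P)) id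
    ((Set.finite_singleton 1).union (hV.union (hP.image f))) ⟨1, Or.inl rfl⟩
  simp only [id] at hmin
  have hTpos : ∀ τ ∈ ({1} ∪ (V ∪ f '' P) : Set ℝ), 0 < τ := by
    rintro τ (rfl | h | ⟨x, hx, rfl⟩)
    · exact one_pos
    · exact hpos _ h
    · exact div_pos (by linarith [hx.2.1, hx.2.2.1]) (by linarith [hx.2.2.2])
  have h0 := hTpos μ₁ hμ₁
  refine ⟨μ₁, h0, hmin 1 (Or.inl rfl), fun ν hν => hmin ν (Or.inr (Or.inl hν)), ?_, ?_⟩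
  · intro w hw w' hw' hwa haw
    by_cases hj : w j < w' j
    · have h1 : μ₁ ≤ f (w, w') :=
        hmin _ (Or.inr (Or.inr ⟨(w, w'), ⟨⟨hw, hw'⟩, hwa, haw, hj⟩, rfl⟩))
      exact (le_div_iff₀ (by linarith)).1 h1
    · nlinarith
  · rcases hμ₁ with h | h | ⟨x, hx, h⟩
    · exact Or.inl h
    · exact Or.inr (Or.inl h)
    · refine Or.inr (Or.inr ⟨x.1, hx.1.1, x.2, hx.1.2, hx.2.1, hx.2.2.1, ?_⟩)
      have : x.2 j - x.1 j ≠ 0 := by linarith [hx.2.2.2]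
      rw [← h]
      exact div_mul_cancel₀ _ this

/-- Below `μ₁` every left intercept `w i - μ * w j` is strictly less than every right one, so some
`c` fits between them. -/
theorem exists_strictlySeparates (hW : W.Finite) {μ₁ μ : ℝ} (hμ : 0 < μ) (hμ1 : μ < μ₁)
    (h : ∀ w ∈ W, ∀ w' ∈ W, w i < a → a ≤ w' i → μ₁ * (w' j - w j) ≤ w' i - w i) :
    ∃ c, StrictlySeparates W i j a μ c := by
  classical
  obtain ⟨c, h1, h2⟩ := Order.exists_between_finsets
    ((hW.toFinset.filter fun w => w i < a).image fun w => w i - μ * w j)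
    ((hW.toFinset.filter fun w => a ≤ w i).image fun w => w i - μ * w j) (by
      simp only [Finset.mem_image, Finset.mem_filter, Set.Finite.mem_toFinset]
      rintro _ ⟨w, ⟨hw, hwa⟩, rfl⟩ _ ⟨w', ⟨hw', haw⟩, rfl⟩
      have := h w hw w' hw' hwa haw
      rcases lt_or_ge (w j) (w' j) with hj | hj <;> nlinarith)
  refine ⟨c, fun w hw => ⟨fun hwa => ?_, fun haw => ?_⟩⟩
  · have := h1 _ (Finset.mem_image_of_mem _ (Finset.mem_filter.2 ⟨hW.mem_toFinset.2 hw, hwa⟩))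
    linarith
  · have := h2 _ (Finset.mem_image_of_mem _ (Finset.mem_filter.2 ⟨hW.mem_toFinset.2 hw, haw⟩))
    linarith

/-- Slide the line until it touches the first right point or, if there is none, the last left point.
-/
theorem exists_separates_through (hW : W.Finite) (hne : W.Nonempty) {μ₁ : ℝ}
    (h : ∀ w ∈ W, ∀ w' ∈ W, w i < a → a ≤ w' i → μ₁ * (w' j - w j) ≤ w' i - w i) :
    ∃ c, Separates W i j a μ₁ c ∧ ∃ w ∈ W, w i = μ₁ * w j + c := by
  by_cases hR : ∃ w ∈ W, a ≤ w i
  · obtain ⟨w, hw, hmin⟩ := Set.exists_min_image {w ∈ W | a ≤ w i} (fun w => w i - μ₁ * w j)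
      (hW.subset fun w hw => hw.1) hR
    refine ⟨w i - μ₁ * w j, fun w' hw' => ⟨fun h' => ?_, fun h' => ?_⟩, w, hw.1, by ring⟩
    · have := h w' hw' w hw.1 h' hw.2
      linarith
    · have := hmin w' ⟨hw', h'⟩
      linarith
  · push Not at hR
    obtain ⟨w, hw, hmax⟩ := Set.exists_max_image W (fun w => w i - μ₁ * w j) hW hne
    refine ⟨w i - μ₁ * w j, fun w' hw' => ⟨fun _ => ?_, fun h' => ?_⟩, w, hw, by ring⟩
    · have := hmax w' hw'
      linarith
    · exact absurd (hR w' hw') (not_lt.2 h')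

theorem StrictlySeparates.combine {μ₀ c₀ μ c t : ℝ} (h₀ : StrictlySeparates W i j a μ₀ c₀)
    (h : Separates W i j a μ c) (ht : 0 < t) (ht1 : t ≤ 1) :
    StrictlySeparates W i j a ((1 - t) * μ + t * μ₀) ((1 - t) * c + t * c₀) := by
  have hs : 0 ≤ 1 - t := by linarith
  refine fun w hw => ⟨fun hwa => ?_, fun haw => ?_⟩
  · have h1 := mul_lt_mul_of_pos_left ((h₀ w hw).1 hwa) ht
    have h2 := mul_le_mul_of_nonneg_left ((h w hw).1 hwa) hs
    linarith
  · have h1 := mul_lt_mul_of_pos_left ((h₀ w hw).2 haw) ht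
    have h2 := mul_le_mul_of_nonneg_left ((h w hw).2 haw) hs
    linarith

theorem tendsto_lineFn_combine (μ₀ c₀ μ c : ℝ) (u : Plane) :
    Tendsto (fun t : ℝ => lineFn i j ((1 - t) * μ + t * μ₀) ((1 - t) * c + t * c₀) u) (𝓝[>] 0)
      (𝓝 (lineFn i j μ c u)) := by
  have hc : Continuous fun t : ℝ =>
      lineFn i j ((1 - t) * μ + t * μ₀) ((1 - t) * c + t * c₀) u := by
    unfold lineFn; fun_prop
  have := hc.tendsto 0
  simp only [sub_zero, one_mul, zero_mul, add_zero] at this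
  exact this.mono_left nhdsWithin_le_nhds

end Cell

/-! ### The closed cell of an axis-parallel line and the descent to a special line. -/

section Main

variable {F : Type u} [Field F] {M : PersistenceModule.{u, w₁} F Plane}
  {N : PersistenceModule.{u, w₂} F Plane} {CM CN : Set Plane} {Ω : Set ProjPlane} {i j : Fin 2}

theorem nonempty_of_not_isTrivial {M : PersistenceModule.{u, w} F Plane}
    (hM : M.PointwiseFinite) {C : Set Plane} (hC : PropertyP M C) (h : ¬ M.IsTrivial) :
    (supClosure C).Nonempty := by
  by_contra hne
  rw [Set.not_nonempty_iff_eq_empty] at hne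
  refine h fun p => ?_
  have := hM p
  have h0 := (hC.2 p p le_rfl).2 (by simp [hne])
  unfold PersistenceModule.rank at h0
  rw [M.map_refl, LinearMap.range_id, finrank_top] at h0
  exact Module.finrank_zero_iff.1 h0

/-- The proper points among the critical values and the switch points. -/
def properPoints (K : Set Plane) (Ω : Set ProjPlane) : Set Plane := K ∪ proper ⁻¹' Ω

theorem properPoints_finite {K : Set Plane} (hK : K.Finite) (hΩ : Ω.Finite) :
    (properPoints K Ω).Finite :=
  hK.union (hΩ.preimage proper_injective.injOn)

theorem proper_mem_of_mem_properPoints {K : Set Plane} {w : Plane} (hw : w ∈ properPoints K Ω) :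
    proper w ∈ proper '' K ∪ (Ω ∩ Set.range proper) :=
  hw.imp (Set.mem_image_of_mem _) fun h => ⟨h, w, rfl⟩

/-- The line passes through two points, as in the conclusion of the theorem. -/
def PosLine.Special (K : Set Plane) (Ω : Set ProjPlane) (L : PosLine) : Prop :=
  ∃ p q : ProjPlane, p ∈ proper '' K ∪ (Ω ∩ Set.range proper) ∧
    q ∈ proper '' K ∪ (Ω ∪ {diagonalPoint}) ∧ p ≠ q ∧ p ∈ L.projCarrier ∧ q ∈ L.projCarrier

/-- The slopes of the points at infinity among the switch points. -/
def switchSlopes (hij : i ≠ j) (Ω : Set ProjPlane) : Set ℝ :=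
  {ν | 0 < ν ∧ atInfinity (direction i ν) (direction_ne_zero hij ν) ∈ Ω}

theorem switchSlopes_finite (hij : i ≠ j) (hΩ : Ω.Finite) : (switchSlopes hij Ω).Finite := by
  refine (hΩ.preimage (f := fun ν => atInfinity (direction i ν) (direction_ne_zero hij ν))
    (Function.Injective.injOn fun ν ν' h => ?_)).subset fun ν hν => hν.2
  obtain ⟨t, ht⟩ := (atInfinity_eq_iff _ _).1 h
  have h1 : t = 1 := by simpa [direction, hij.symm] using congrFun ht j
  simpa [direction, h1] using (congrFun ht i).symm

theorem atInfinity_eq_direction (hij : i ≠ j) {v : Plane} (hv : v ≠ 0) (hpos : ∀ k, 0 < v k) :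
    atInfinity v hv = atInfinity (direction i (v i / v j)) (direction_ne_zero hij _) := by
  have := (hpos j).ne'
  refine (atInfinity_eq_iff _ _).2 ⟨v j, funext ((forall_fin_two_of_ne hij).2 ⟨?_, ?_⟩)⟩
  · simp only [direction, Pi.smul_apply, if_true, smul_eq_mul]; field_simp
  · simp [direction, hij.symm]

theorem proper_mem_projCarrier (hij : i ≠ j) {μ c : ℝ} (hμ : 0 < μ) (hμ1 : μ ≤ 1) {x : Plane}
    (hx : x i = μ * x j + c) : proper x ∈ (steepLine hij μ c hμ hμ1).projCarrier := by
  refine Or.inl ⟨x, ?_, rfl⟩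
  exact PosLine.exists_pt_eq _ hij (steepLine_m_right hij hμ hμ1)
    (by rw [steepLine_m_left, steepLine_offset]; exact hx)

/-- The second point lies at infinity: the diagonal point when `μ = 1`, a switch point otherwise. -/
theorem special_of_slope (hij : i ≠ j) {K : Set Plane} {μ c : ℝ} (hμ : 0 < μ) (hμ1 : μ ≤ 1)
    {w : Plane} (hw : w ∈ properPoints K Ω) (hwc : w i = μ * w j + c)
    (h : μ = 1 ∨ μ ∈ switchSlopes hij Ω) : (steepLine hij μ c hμ hμ1).Special K Ω := by
  refine ⟨proper w, atInfinity (direction i μ) (direction_ne_zero hij μ),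
    proper_mem_of_mem_properPoints hw, Or.inr ?_, proper_ne_atInfinity _ _ _,
    proper_mem_projCarrier hij hμ hμ1 hwc, Or.inr rfl⟩
  rcases h with rfl | h
  · refine Or.inr ?_
    have : direction i 1 = fun _ => 1 := by funext k; simp [direction]
    simp only [diagonalPoint, this, Set.mem_singleton_iff]
  · exact Or.inl h.2

theorem special_of_crossing (hij : i ≠ j) {K : Set Plane} {μ c : ℝ} (hμ : 0 < μ) (hμ1 : μ ≤ 1)
    {w w' : Plane} (hw : w ∈ properPoints K Ω) (hwc : w i = μ * w j + c)
    (hw' : w' ∈ properPoints K Ω) (hwc' : w' i = μ * w' j + c) (hne : w ≠ w') :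
    (steepLine hij μ c hμ hμ1).Special K Ω :=
  ⟨proper w, proper w', proper_mem_of_mem_properPoints hw,
    (proper_mem_of_mem_properPoints hw').imp_right fun h => Or.inl h.1,
    proper_injective.ne hne, proper_mem_projCarrier hij hμ hμ1 hwc,
    proper_mem_projCarrier hij hμ hμ1 hwc'⟩

/-- The cost is given by a single term near the lines that separate the proper points in the same
way as the axis-parallel line, and a special line is among them. -/
theorem exists_cell (hij : i ≠ j) (hM : M.PointwiseFinite) (hN : N.PointwiseFinite)
    (hCM : PropertyP M CM) (hCN : PropertyP N CN)
    (hΩ : PropertyQ (supClosure CM ∪ supClosure CN) Ω)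
    (hne : (supClosure CM ∪ supClosure CN).Nonempty) (a : ℝ) :
    ∃ y ∈ termsOn (supClosure CM ∪ supClosure CN), ∃ (μ₁ c₁ : ℝ) (hμ : 0 < μ₁) (hμ1 : μ₁ ≤ 1),
      (steepLine hij μ₁ c₁ hμ hμ1).Special (supClosure CM ∪ supClosure CN) Ω ∧
      Separates (properPoints (supClosure CM ∪ supClosure CN) Ω) i j a μ₁ c₁ ∧
      ∀ μ c, 0 ≤ μ → μ ≤ μ₁ →
        Separates (properPoints (supClosure CM ∪ supClosure CN) Ω) i j a μ c →
        CostAt M N (supClosure CM) (supClosure CN) (lineFn i j μ c)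
          (termValue (lineFn i j μ c) y) := by
  set K := supClosure CM ∪ supClosure CN with hK
  set W := properPoints K Ω with hWdef
  have hW : W.Finite := properPoints_finite (hCM.1.supClosure.union hCN.1.supClosure) hΩ.1
  have hWne : W.Nonempty := hne.mono Set.subset_union_left
  obtain ⟨μ₁, hμ, hμ1, hslope, hcross, hcase⟩ := exists_critical_slope (i := i) (j := j) (a := a) hW
    (switchSlopes_finite hij hΩ.1) (fun ν hν => hν.1)
  have hspecial : ∃ c₁, (steepLine hij μ₁ c₁ hμ hμ1).Special K Ω ∧ Separates W i j a μ₁ c₁ := by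
    have hthrough : μ₁ = 1 ∨ μ₁ ∈ switchSlopes hij Ω →
        ∃ c₁, (steepLine hij μ₁ c₁ hμ hμ1).Special K Ω ∧ Separates W i j a μ₁ c₁ := fun h => by
      obtain ⟨c₁, hc₁, w, hw, hwc⟩ := exists_separates_through hW hWne hcross
      exact ⟨c₁, special_of_slope hij hμ hμ1 hw hwc h, hc₁⟩
    rcases hcase with h | h | ⟨w, hw, w', hw', hwa, haw, h⟩
    · exact hthrough (Or.inl h)
    · exact hthrough (Or.inr h)
    · refine ⟨w i - μ₁ * w j, special_of_crossing hij hμ hμ1 hw (by ring) hw' (by linarith) ?_, ?_⟩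
      · rintro rfl
        exact absurd hwa (not_lt.2 haw)
      · refine fun x hx => ⟨fun hxa => ?_, fun hax => ?_⟩
        · have := hcross x hx w' hw' hxa haw
          linarith
        · have := hcross w hw x hx hwa hax
          linarith
  obtain ⟨c₁, hsp, hsep⟩ := hspecial
  -- A reference line in the open cell; any slope strictly between `0` and `μ₁` would do.
  obtain ⟨c₀, hc₀⟩ := exists_strictlySeparates hW (half_pos hμ) (half_lt_self hμ) hcross
  have hL₀1 : μ₁ / 2 ≤ 1 := by linarith
  let L₀ := steepLine hij (μ₁ / 2) c₀ (half_pos hμ) hL₀1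
  obtain ⟨y, hy, hcost⟩ := exists_term_costAt hM hN hCM hCN L₀
  refine ⟨y, hy, μ₁, c₁, hμ, hμ1, hsp, hsep, fun μ c h0 h1 hsep' => hcost _ ?_⟩
  -- A point of the closed cell is the limit of its proper convex combinations with the reference
  -- line. These lie in the open cell, where (Q) applies.
  refine Compat.of_tendsto (l := 𝓝[>] (0 : ℝ)) ?_
    fun u _ => tendsto_lineFn_combine (μ₁ / 2) c₀ μ c u
  filter_upwards [Ioc_mem_nhdsGT one_pos] with t ht
  have hμt : 0 < (1 - t) * μ + t * (μ₁ / 2) := by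
    have h2 : 0 < t * (μ₁ / 2) := mul_pos ht.1 (half_pos hμ)
    have h3 : 0 ≤ (1 - t) * μ := mul_nonneg (by linarith [ht.2]) h0
    linarith
  have hμt' : (1 - t) * μ + t * (μ₁ / 2) < μ₁ := by
    have h2 : t * (μ₁ / 2) < t * μ₁ := mul_lt_mul_of_pos_left (half_lt_self hμ) ht.1
    have h3 : (1 - t) * μ ≤ (1 - t) * μ₁ := mul_le_mul_of_nonneg_left h1 (by linarith [ht.2])
    linarith
  set μt := (1 - t) * μ + t * (μ₁ / 2)
  have hsept := hc₀.combine hsep' ht.1 ht.2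
  set ct := (1 - t) * c + t * c₀
  let L := steepLine hij μt ct hμt (hμt'.le.trans hμ1)
  have hequiv : PosLine.Equivalent (proper '' K ∪ Ω) L₀ L := by
    refine PosLine.equivalent_of_separate hij (steepLine_m_right _ _ _) (steepLine_m_right _ _ _)
      (fun u hu => ?_) (fun v hv hpos hvU => ?_)
    · simp only [L₀, L, steepLine_m_left, steepLine_offset]
      have huW : u ∈ W := hu.imp (fun ⟨x, hx, hxu⟩ => proper_injective hxu ▸ hx) fun h => h
      rcases lt_or_ge (u i) a with h | h
      · exact Or.inl ⟨(hc₀ u huW).1 h, (hsept u huW).1 h⟩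
      · exact Or.inr ⟨(hc₀ u huW).2 h, (hsept u huW).2 h⟩
    · simp only [L₀, L, steepLine_m_left]
      have hvΩ : atInfinity v hv ∈ Ω := by
        rcases hvU with ⟨x, -, hx⟩ | h
        · exact absurd hx (proper_ne_atInfinity _ _ _)
        · exact h
      rw [atInfinity_eq_direction hij hv hpos] at hvΩ
      have h2 : μ₁ ≤ v i / v j := hslope _ ⟨div_pos (hpos i) (hpos j), hvΩ⟩
      rw [← lt_div_iff₀ (hpos j), ← lt_div_iff₀ (hpos j)]
      exact ⟨by linarith, hμt'.trans_le h2⟩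
  refine (compat_of_equivalent hΩ hequiv).affine L.weight_pos (β := L.b i) fun u => ?_
  have := L.lineFn_eq hij (steepLine_m_right _ _ _) u
  rwa [steepLine_m_left, steepLine_offset] at this

theorem costAt_steepLine (hij : i ≠ j) (hM : M.PointwiseFinite) (hN : N.PointwiseFinite)
    (hCM : PropertyP M CM) (hCN : PropertyP N CN) {μ c : ℝ} (hμ : 0 < μ) (hμ1 : μ ≤ 1) :
    CostAt M N (supClosure CM) (supClosure CN) (lineFn i j μ c)
      (weightedDist M N (steepLine hij μ c hμ hμ1)) := by
  refine costAt_weightedDist hM hN hCM hCN _ (β := (steepLine hij μ c hμ hμ1).b i) fun u => ?_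
  have := (steepLine hij μ c hμ hμ1).lineFn_eq hij (steepLine_m_right _ _ _) u
  rwa [steepLine_m_left, steepLine_offset] at this

/-- Passing through `r` forces the offset `r i - m i * r j`, which tends to `r i = a`. Only `a`
survives in the limit, whence the independence of `r`. -/
theorem isAxisCost_of_costAt (hij : i ≠ j) (hM : M.PointwiseFinite) (hN : N.PointwiseFinite)
    (hCM : PropertyP M CM) (hCN : PropertyP N CN) {a : ℝ} {κ : ℝ≥0∞}
    (hκ : CostAt M N (supClosure CM) (supClosure CN) (lineFn i j 0 a) κ) :
    IsAxisCost M N i a κ := by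
  intro r hr
  have hm0 : Tendsto (fun L : PosLine => L.m i)
      (comap (fun L : PosLine => L.m i) (𝓝[>] 0) ⊓ 𝓟 {L | r ∈ L.carrier}) (𝓝[>] 0) :=
    tendsto_comap.mono_left inf_le_left
  refine tendsto_weightedDist hM hN hCM hCN
    (G := fun L => lineFn i j (L.m i) (r i - L.m i * r j)) (supMap_lineFn i j le_rfl a) ?_
    (fun u => ?_) hκ
  · filter_upwards [hm0 (Ioo_mem_nhdsGT one_pos), mem_inf_of_right (mem_principal_self _)]
      with L hL hrL
    have hm : L.m j = 1 := by
      have := L.m_max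
      rcases fin_two_cases hij 0 with h | h <;> rcases fin_two_cases hij 1 with h' | h' <;>
        rw [h, h'] at this
      · omega
      · exact (max_choice (L.m i) (L.m j)).elim (fun h => absurd (h.symm.trans this) hL.2.ne)
          fun h => h.symm.trans this
      · exact (max_choice (L.m j) (L.m i)).elim (fun h => h.symm.trans this)
          fun h => absurd (h.symm.trans this) hL.2.ne
      · omega
    refine ⟨L.b i, fun u => ?_⟩
    rw [← L.lineFn_eq hij hm u]
    obtain ⟨s, rfl⟩ := hrL
    rw [L.pt_apply_eq (i := i) hm s, add_sub_cancel_left]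
  · have hc : Continuous fun m : ℝ => lineFn i j m (r i - m * r j) u := by
      unfold lineFn; fun_prop
    have h1 := (hc.tendsto 0).comp (hm0.mono_right nhdsWithin_le_nhds)
    simpa only [zero_mul, sub_zero, hr, Function.comp_def] using h1

theorem ofReal_abs_div_comm (x y : ℝ) (k : ℕ) :
    ENNReal.ofReal (|x - y| / k) = ENNReal.ofReal (|y - x| / k) := by rw [abs_sub_comm]

/-- The induction is on the number of points strictly to the left of `x i = a`. Either the term is
at least as large on the special line of the cell, or it grows when the axis-parallel line moves
left to the next point of `W`. -/
theorem exists_special_ge (hij : i ≠ j) (hM : M.PointwiseFinite) (hN : N.PointwiseFinite)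
    (hCM : PropertyP M CM) (hCN : PropertyP N CN)
    (hΩ : PropertyQ (supClosure CM ∪ supClosure CN) Ω)
    (hne : (supClosure CM ∪ supClosure CN).Nonempty) (n : ℕ) :
    ∀ a : ℝ, {w ∈ properPoints (supClosure CM ∪ supClosure CN) Ω | w i < a}.ncard ≤ n →
    ∃ κ, CostAt M N (supClosure CM) (supClosure CN) (lineFn i j 0 a) κ ∧
      ∃ L : PosLine, L.Special (supClosure CM ∪ supClosure CN) Ω ∧ κ ≤ weightedDist M N L := by
  have hWfin : (properPoints (supClosure CM ∪ supClosure CN) Ω).Finite :=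
    properPoints_finite (hCM.1.supClosure.union hCN.1.supClosure) hΩ.1
  have hKW : supClosure CM ∪ supClosure CN ⊆ properPoints (supClosure CM ∪ supClosure CN) Ω :=
    Set.subset_union_left
  induction n using Nat.strong_induction_on with
  | _ n ih =>
  intro a ha
  obtain ⟨y, hy, μ₁, c₁, hμ, hμ1, hsp, hsep, hcost⟩ := exists_cell hij hM hN hCM hCN hΩ hne a
  set W := properPoints (supClosure CM ∪ supClosure CN) Ω with hW
  -- The axis-parallel line itself is the point `(0, a)` of the closed cell.
  have hsepa : Separates W i j a 0 a := fun w _ =>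
    ⟨fun h => by linarith, fun h => by linarith⟩
  have hκ := hcost 0 a le_rfl hμ.le hsepa
  have hL : weightedDist M N (steepLine hij μ₁ c₁ hμ hμ1) = termValue (lineFn i j μ₁ c₁) y :=
    (costAt_steepLine hij hM hN hCM hCN hμ hμ1).unique hCM.1 hCN.1
      (supMap_lineFn i j hμ.le c₁) (hcost μ₁ c₁ hμ.le le_rfl hsep)
  refine ⟨_, hκ, ?_⟩
  have hdone : termValue (lineFn i j 0 a) y ≤ termValue (lineFn i j μ₁ c₁) y →
      ∃ L : PosLine, L.Special (supClosure CM ∪ supClosure CN) Ω ∧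
        termValue (lineFn i j 0 a) y ≤ weightedDist M N L :=
    fun h => ⟨_, hsp, hL ▸ h⟩
  obtain ⟨u, v, k⟩ := y
  obtain ⟨hu, hv, hk⟩ := hy
  simp only at hu hv hk
  induction u using WithTop.recTopCoe with
  | top =>
    induction v using WithTop.recTopCoe with
    | top => exact hdone (by simp [termValue_top_top])
    | coe v => exact hdone (by simp [termValue_top_coe])
  | coe u =>
    induction v using WithTop.recTopCoe with
    | top => exact hdone (by simp [termValue_coe_top])
    | coe v =>
      replace hu := hKW (hu u rfl)
      replace hv := hKW (hv v rfl)
      simp only [termValue_coe _ _ _ hk] at hκ hdone hcost ⊢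
      have hkpos : (0 : ℝ) < k := by rcases hk with rfl | rfl <;> norm_num
      -- exchange the two ends if necessary
      wlog huv : lineFn i j 0 a v ≤ lineFn i j 0 a u generalizing u v
      · have hcost' := hcost
        simp only [ofReal_abs_div_comm _ (lineFn i j _ _ v)] at hcost' hκ hdone ⊢
        refine this v u ?_ hv hu hκ hdone hcost' (not_le.1 huv).le
        rw [hL, termValue_coe _ _ _ hk, termValue_coe _ _ _ hk, ofReal_abs_div_comm]
      have hfa : ∀ x : Plane, lineFn i j 0 a x = max (x i) a := fun x => by simp [lineFn]
      rcases huv.eq_or_lt with heq | hlt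
      · exact hdone (by simp [heq])
      -- Every value on the axis-parallel line is at least `a`, so the strictly larger one belongs
      -- to a point strictly to its right.
      have hua : a < u i := by
        rw [hfa, hfa] at hlt
        exact (lt_max_iff.1 ((le_max_right _ _).trans_lt hlt)).resolve_right (lt_irrefl _)
      have hur : ∀ μ c, Separates W i j a μ c → lineFn i j μ c u = u i := fun μ c h =>
        max_eq_left ((h u hu).2 hua.le)
      by_cases hva : a ≤ v i
      · have hvr : ∀ μ c, Separates W i j a μ c → lineFn i j μ c v = v i := fun μ c h =>
          max_eq_left ((h v hv).2 hva)
        apply hdone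
        rw [hur _ _ hsepa, hvr _ _ hsepa, hur _ _ hsep, hvr _ _ hsep]
      -- pass to the next axis-parallel line to the left
      rw [not_le] at hva
      obtain ⟨w, hw, hmax⟩ := Set.exists_max_image {w ∈ W | w i < a} (fun w => w i)
        (hWfin.subset fun w hw => hw.1) ⟨v, hv, hva⟩
      -- No point of `W` lies strictly between the two axis-parallel lines, so the new one belongs
      -- to the closed cell of `a` and its cost is given by the same term. The left end `v` moves
      -- from `a` down to `w i`, while `u` stays put.
      have hsepw : Separates W i j a 0 (w i) := fun x hx =>
        ⟨fun h => by have := hmax x ⟨hx, h⟩; simpa using this,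
          fun h => by have := hw.2; simp only [zero_mul, zero_add]; linarith⟩
      have hcard : {x ∈ W | x i < w i}.ncard < n := by
        refine lt_of_lt_of_le (Set.ncard_lt_ncard ?_ (hWfin.subset fun w hw => hw.1)) ha
        refine ⟨fun x hx => ⟨hx.1, hx.2.trans hw.2⟩, fun h => ?_⟩
        exact lt_irrefl _ (h hw).2
      obtain ⟨κ, hκ', L, hLsp, hLκ⟩ := ih _ hcard (w i) le_rfl
      refine ⟨L, hLsp, le_trans ?_ hLκ⟩
      rw [hκ'.unique hCM.1 hCN.1 (supMap_lineFn i j le_rfl _)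
        (hcost 0 (w i) le_rfl hμ.le hsepw), hur _ _ hsepa, hur _ _ hsepw, hfa,
        max_eq_right hva.le]
      have hvw : lineFn i j 0 (w i) v = w i := by
        have := hmax v ⟨hv, hva⟩
        simpa [lineFn] using this
      rw [hvw]
      refine ENNReal.ofReal_le_ofReal (div_le_div_of_nonneg_right ?_ hkpos.le)
      have := hw.2
      rw [abs_of_pos (by linarith), abs_of_pos (by linarith)]
      linarith

end Main

end MatchingDistance

universe u w₁ w₂

open MatchingDistance in
theorem corollary3p10 {F : Type u} [Field F]
    (M : PersistenceModule.{u, w₁} F Plane) (N : PersistenceModule.{u, w₂} F Plane)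
    (hM : M.PointwiseFinite) (hN : N.PointwiseFinite)
    (hMN : ¬ (M.IsTrivial ∧ N.IsTrivial))
    (CM CN : Set Plane) (hCM : PropertyP M CM) (hCN : PropertyP N CN)
    (Ω : Set ProjPlane) (hΩ : PropertyQ (supClosure CM ∪ supClosure CN) Ω)
    -- `i = 0`: vertical lines, `i = 1`: horizontal lines
    (i : Fin 2) (a : ℝ) :
    ∃ κ : ENNReal, IsAxisCost M N i a κ ∧
      ∃ (L : PosLine) (p q : ProjPlane),
        p ∈ proper '' (supClosure CM ∪ supClosure CN) ∪ (Ω ∩ Set.range proper) ∧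
        q ∈ proper '' (supClosure CM ∪ supClosure CN) ∪ (Ω ∪ {diagonalPoint}) ∧
        p ≠ q ∧ p ∈ L.projCarrier ∧ q ∈ L.projCarrier ∧
        κ ≤ weightedDist M N L := by
  obtain ⟨j, hij⟩ := exists_ne i
  have hne : (supClosure CM ∪ supClosure CN).Nonempty := by
    rcases not_and_or.1 hMN with h | h
    · exact (nonempty_of_not_isTrivial hM hCM h).mono Set.subset_union_left
    · exact (nonempty_of_not_isTrivial hN hCN h).mono Set.subset_union_right
  obtain ⟨κ, hκ, L, ⟨p, q, hp, hq, hpq, hpL, hqL⟩, hL⟩ :=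
    exists_special_ge hij.symm hM hN hCM hCN hΩ hne _ a le_rfl
  exact ⟨κ, isAxisCost_of_costAt hij.symm hM hN hCM hCN hκ, L, p, q, hp, hq, hpq, hpL, hqL, hL⟩
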